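/- **Soundness of target trace equivalence.** *Source.* A source program is a list of modules (module-global variables and functions) with a layout $\beta$ assigning to each global variable an interval of cells of its module's data segment and to each argument and local variable an interval of cells of its function's stack frame; commands are assignment, allocation, call, return, conditional jump and exit; expressions are integers, variables, binary arithmetic, $e[e]$, $\&x$, $\&e[e]$, ${}^{*}(e)$, and $\mathsf{start},\mathsf{end},\mathsf{offset},\mathsf{capType},\mathsf{limRange}$. It is well formed if names are unique, function bodies are non-empty, and distinct variables have disjoint places (the $i$-th argument being the $i$-th cell of the frame). *Target.* The target language has the same commands, over expressions in which variables are replaced by the capability registers $\mathsf{ddc}$ and $\mathsf{stc}$ (readable through $\mathsf{getddc}$, $\mathsf{getstc}$), with $\mathsf{inc}$ and $\mathsf{deref}$. A value is an integer or a capability (type code/data, start, end, offset); memory accesses need a data capability whose offset is in bounds, and $\mathsf{limRange}$ can only shrink the bounds. A target program is a list of modules, each with a data segment, a data stack, and functions at fixed places of the code memory. Execution states consist of the memory, the next free address $\mathit{nalloc}$ of a downward growing heap of at most $\nabla$ cells ($\nabla\in\mathbb N$ fixed), a trusted control stack, the registers $\mathsf{ddc},\mathsf{stc},\mathsf{pcc}$,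 and one stack capability per module. The compiler $\llbracket\cdot\rrbracket_L$, given load-time locations $L$ of the segments, stacks and functions, is the command-by-command translation in which $\&x$ becomes the capability $\mathsf{ddc}$ (for a global variable) or $\mathsf{stc}$ (for a local variable or an argument) restricted by $\mathsf{limRange}$ to the bounds of $x$. *Contextual equivalence.* For target programs $C,p$, the linked program $C[p]$ is executable if it is well formed (unique names, disjoint segments at nonnegative addresses, disjoint non-empty functions), every function it calls is one of its own, and it has a main function without arguments. It converges, $C[p]\Downarrow$, if its initial state reduces to a state that executes exit. Then $p_1\simeq p_2$ means: for every context $C$ such that $C[p_1]$ and $C[p_2]$ are both executable, $C[p_1]\Downarrow\iff C[p_2]\Downarrow$. *Traces.* A step of $C[p]$ is labeled with $p$ as the program of interest, along with the set $\varsigma$ of the addresses shared so far (initially empty). Steps that stay within $p$ or within $C$ are silent; a state that executes exit emits $\checkmark$ and does not change; a call or return that crosses the border between $C$ and $p$ emits $\mathtt{call}(\mathit{fid})\,\overline v\,d\,\mathit{Mem},\mathit{nalloc}$ or $\mathtt{ret}\,d\,\mathit{Mem},\mathit{nalloc}$, where $d$ is ? (into $p$) or ! (out of $p$), $\varsigma$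 is replaced by the set $\varsigma'$ of the addresses reachable in memory from $\varsigma$ and from the arguments $\overline v$, and $\mathit{Mem}$ is the memory at the call or return restricted to $\varsigma'$. $\mathrm{Tr}(p)$ is the set of the finite sequences of non-silent labels emitted, from the initial state, by $C[p]$ for some context $C$ such that $C[p]$ is executable. *Claim.* For all well-formed source programs $p_1,p_2$ and all $L_1,L_2$ for which the compilations are defined, if $\llbracket p_1\rrbracket_{L_1}\not\simeq\llbracket p_2\rrbracket_{L_2}$ then $\mathrm{Tr}(\llbracket p_1\rrbracket_{L_1})\neq\mathrm{Tr}(\llbracket p_2\rrbracket_{L_2})$. Hence $\mathrm{Tr}(\llbracket p_1\rrbracket_{L_1})=\mathrm{Tr}(\llbracket p_2\rrbracket_{L_2})$ implies $\llbracket p_1\rrbracket_{L_1}\simeq\llbracket p_2\rrbracket_{L_2}$. -/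

import Mathlib

namespace CapPtrs

/-! ### Syntax shared by the two languages -/

/-- Module identifiers. -/
abbrev ModID := ℕ

/-- Function identifiers (unique in a whole program). -/
abbrev FunID := ℕ

/-- Variable identifiers. -/
abbrev VarID := ℕ

/-- The identifier of the entry-point function. -/
def mainId : FunID := 0

/-- The binary arithmetic operators of both expression languages. -/
inductive BinOp where
  | add | sub | mul | div | mod | eq | lt

/-- Meaning of the arithmetic operators; division by zero has no value. -/
def BinOp.eval : BinOp → ℤ → ℤ → Option ℤ
  | .add, a, b => some (a + b)
  | .sub, a, b => some (a - b)
  | .mul, a, b => some (a * b)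
  | .div, a, b => if b = 0 then none else some (a / b)
  | .mod, a, b => if b = 0 then none else some (a % b)
  | .eq, a, b => some (if a = b then 1 else 0)
  | .lt, a, b => some (if a < b then 1 else 0)

/-- Commands; the two languages have the same commands up to the language `E` of expressions. -/
inductive Cmd (E : Type) where
  | assign (el er : E)
  | alloc (el esize : E)
  | call (fid : FunID) (args : List E)
  | ret
  | jumpIfZero (ec eoff : E)
  | exit

/-! ### Source programs -/

/-- Source expressions. `idx a i` is `a[i]`, `addrVar x` is `&x`, `addrIdx a i` is `&a[i]`,
`deref e` is `*(e)`. -/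
inductive SExp where
  | int (z : ℤ)
  | var (x : VarID)
  | bin (op : BinOp) (e₁ e₂ : SExp)
  | idx (a i : SExp)
  | addrVar (x : VarID)
  | addrIdx (a i : SExp)
  | deref (e : SExp)
  | startOf (e : SExp)
  | endOf (e : SExp)
  | offset (e : SExp)
  | capType (e : SExp)
  | limRange (e₁ e₂ e₃ : SExp)

/-- A source function. -/
structure SFun where
  id : FunID
  args : List VarID
  locals : List VarID
  body : List (Cmd SExp)

/-- A source module: its module-global variables and its functions. -/
structure SModule where
  id : ModID
  vars : List VarID
  funs : List SFun

/-- A (partial) source program: a list of modules, and the layout and bounds `β` of its variables.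
`β x none mid = some (st, en)` places the global variable `x` of module `mid` at the cells
`[st, en)` of the data segment of `mid`; `β x (some fid) mid = some (st, en)` places the argument or
local variable `x` of the function `fid` of `mid` at the cells `[st, en)` of its stack frames. -/
structure SProgram where
  modules : List SModule
  β : VarID → Option FunID → ModID → Option (ℤ × ℤ)

/-- All the functions of a source program. -/
def SProgram.funs (p : SProgram) : List SFun := p.modules.flatMap SModule.funs

/-- Two variables are laid out on disjoint intervals of nonnegative cells. -/
def Apart (b₁ b₂ : Option (ℤ × ℤ)) : Prop :=
  ∃ s₁ e₁ s₂ e₂ : ℤ, b₁ = some (s₁, e₁) ∧ b₂ = some (s₂, e₂) ∧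
    Disjoint (Set.Ico s₁ e₁) (Set.Ico s₂ e₂)

/-- Well-formed source programs: names are unique, function bodies are not empty, every declared
variable has a place of its own, and the `i`-th argument is a single cell, the `i`-th one of the
frame. -/
structure SProgram.WellFormed (p : SProgram) : Prop where
  modules_nodup : (p.modules.map SModule.id).Nodup
  funs_nodup : (p.funs.map SFun.id).Nodup
  vars_nodup : ∀ m ∈ p.modules, m.vars.Nodup
  locals_nodup : ∀ f ∈ p.funs, (f.args ++ f.locals).Nodup
  body_ne : ∀ f ∈ p.funs, f.body ≠ []
  vars_placed : ∀ m ∈ p.modules, ∀ x ∈ m.vars,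
    ∃ st en : ℤ, p.β x none m.id = some (st, en) ∧ 0 ≤ st ∧ st ≤ en
  vars_apart : ∀ m ∈ p.modules, ∀ x ∈ m.vars, ∀ y ∈ m.vars, x ≠ y →
    Apart (p.β x none m.id) (p.β y none m.id)
  args_placed : ∀ m ∈ p.modules, ∀ f ∈ m.funs, ∀ (i : ℕ) (x : VarID), f.args[i]? = some x →
    p.β x (some f.id) m.id = some ((i : ℤ), (i : ℤ) + 1)
  locals_placed : ∀ m ∈ p.modules, ∀ f ∈ m.funs, ∀ x ∈ f.locals,
    ∃ st en : ℤ, p.β x (some f.id) m.id = some (st, en) ∧ 0 ≤ st ∧ st ≤ en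
  locals_apart : ∀ m ∈ p.modules, ∀ f ∈ m.funs, ∀ x ∈ f.args ++ f.locals,
    ∀ y ∈ f.args ++ f.locals, x ≠ y → Apart (p.β x (some f.id) m.id) (p.β y (some f.id) m.id)

/-! ### Target programs -/

/-- Target expressions. -/
inductive TExp where
  | int (z : ℤ)
  | getddc
  | getstc
  | bin (op : BinOp) (e₁ e₂ : TExp)
  | inc (e ez : TExp)
  | deref (e : TExp)
  | startOf (e : TExp)
  | endOf (e : TExp)
  | offset (e : TExp)
  | capType (e : TExp)
  | limRange (e₁ e₂ e₃ : TExp)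

/-- The type of a capability: code (`κ`) or data (`δ`). -/
inductive CapKind where
  | κ | δ

/-- Capabilities: type, start, end, offset. -/
structure Cap where
  kind : CapKind
  st : ℤ
  en : ℤ
  off : ℤ

/-- The addresses on which a capability confers authority. -/
def Cap.range (c : Cap) : Set ℤ := Set.Ico c.st c.en

/-- Changing the offset of a capability. -/
def Cap.inc (c : Cap) (z : ℤ) : Cap := { c with off := c.off + z }

/-- `c` is a data capability whose offset is within its bounds, and designates the address `a`. -/
def Cap.DataAt (c : Cap) (a : ℤ) : Prop :=
  c.kind = .δ ∧ a = c.st + c.off ∧ c.st ≤ a ∧ a < c.en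

/-- Run-time values. -/
inductive Val where
  | int (z : ℤ)
  | cap (c : Cap)

/-- The addresses that a value gives access to. -/
def Val.addrs : Val → Set ℤ
  | .int _ => ∅
  | .cap c => {a | c.kind = .δ ∧ a ∈ c.range}

/-- Data memories: partial maps from addresses to values. -/
abbrev Mem := ℤ → Option Val

/-- A target function: its identifier, the number of its arguments, the size of its stack frames
(whose first cells hold the arguments), the address of its first command in the code memory, and its
commands. -/
structure TFun where
  id : FunID
  nArgs : ℕ
  frame : ℕ
  codeStart : ℤ
  code : List (Cmd TExp)

/-- The code capability of a function, at its entry point. -/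
def TFun.codeCap (f : TFun) : Cap := ⟨.κ, f.codeStart, f.codeStart + f.code.length, 0⟩

/-- A target module: the bounds of its data segment and of its data stack, and its functions. -/
structure TModule where
  id : ModID
  data : ℤ × ℤ
  stack : ℤ × ℤ
  funs : List TFun

/-- The default data capability of a module. -/
def TModule.dataCap (m : TModule) : Cap := ⟨.δ, m.data.1, m.data.2, 0⟩

/-- The capability on the data stack of a module, when the stack is empty. -/
def TModule.stackCap (m : TModule) : Cap := ⟨.δ, m.stack.1, m.stack.2, 0⟩

/-- A (partial) target program. -/
abbrev TProgram := List TModule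

/-- Linking of a context with a program: `C[p]`. -/
def link (C p : TProgram) : TProgram := C ++ p

/-- All the functions of a target program. -/
def TProgram.funs (P : TProgram) : List TFun := List.flatMap TModule.funs P

/-- The statically allocated segments of a target program. -/
def TProgram.segments (P : TProgram) : List (ℤ × ℤ) := List.flatMap (fun m => [m.data, m.stack]) P

/-- The domain of the code memory of a target program. -/
def TProgram.codeDom (P : TProgram) : Set ℤ := {a | ∃ f ∈ P.funs, a ∈ f.codeCap.range}

/-- `f` is a function of the module `m` of `P`. -/
def TProgram.HasFun (P : TProgram) (m : TModule) (f : TFun) : Prop := m ∈ P ∧ f ∈ m.funs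

/-- `P` can be executed: it is well formed (names are unique, the segments are disjoint and do not
meet the heap, which occupies negative addresses, and the functions occupy disjoint parts of the
code memory), it is whole (it refers to functions of its own only), and it has an entry point. -/
structure TProgram.Executable (P : TProgram) : Prop where
  modules_nodup : (List.map TModule.id P).Nodup
  funs_nodup : (P.funs.map TFun.id).Nodup
  segments_nonneg : ∀ I ∈ P.segments, 0 ≤ I.1 ∧ I.1 ≤ I.2
  segments_disjoint : P.segments.Pairwise fun I J => Disjoint (Set.Ico I.1 I.2) (Set.Ico J.1 J.2)
  code_ne : ∀ f ∈ P.funs, f.code ≠ []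
  code_disjoint : P.funs.Pairwise fun f g => Disjoint f.codeCap.range g.codeCap.range
  args_le : ∀ f ∈ P.funs, f.nArgs ≤ f.frame
  whole : ∀ f ∈ P.funs, ∀ (fid : FunID) (es : List TExp), Cmd.call fid es ∈ f.code →
    ∃ g ∈ P.funs, g.id = fid
  main : ∃ f ∈ P.funs, f.id = mainId ∧ f.nArgs = 0

/-! ### Semantics of whole target programs -/

/-- Evaluation of target expressions. -/
inductive Eval (M : Mem) (ddc stc : Cap) : TExp → Val → Prop
  | int (z : ℤ) : Eval M ddc stc (.int z) (.int z)
  | getddc : Eval M ddc stc .getddc (.cap ddc)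
  | getstc : Eval M ddc stc .getstc (.cap stc)
  | bin {op : BinOp} {e₁ e₂ : TExp} {z₁ z₂ z : ℤ} :
      Eval M ddc stc e₁ (.int z₁) → Eval M ddc stc e₂ (.int z₂) → op.eval z₁ z₂ = some z →
      Eval M ddc stc (.bin op e₁ e₂) (.int z)
  | inc {e ez : TExp} {c : Cap} {z : ℤ} :
      Eval M ddc stc e (.cap c) → Eval M ddc stc ez (.int z) →
      Eval M ddc stc (.inc e ez) (.cap (c.inc z))
  | deref {e : TExp} {c : Cap} {a : ℤ} {v : Val} :
      Eval M ddc stc e (.cap c) → c.DataAt a → M a = some v →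
      Eval M ddc stc (.deref e) v
  | startOf {e : TExp} {c : Cap} :
      Eval M ddc stc e (.cap c) → Eval M ddc stc (.startOf e) (.int c.st)
  | endOf {e : TExp} {c : Cap} :
      Eval M ddc stc e (.cap c) → Eval M ddc stc (.endOf e) (.int c.en)
  | offset {e : TExp} {c : Cap} :
      Eval M ddc stc e (.cap c) → Eval M ddc stc (.offset e) (.int c.off)
  | capTypeCode {e : TExp} {c : Cap} :
      Eval M ddc stc e (.cap c) → c.kind = .κ → Eval M ddc stc (.capType e) (.int 0)
  | capTypeData {e : TExp} {c : Cap} :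
      Eval M ddc stc e (.cap c) → c.kind = .δ → Eval M ddc stc (.capType e) (.int 1)
  | limRange {e₁ e₂ e₃ : TExp} {c : Cap} {st' en' : ℤ} :
      Eval M ddc stc e₁ (.cap c) → Eval M ddc stc e₂ (.int st') → Eval M ddc stc e₃ (.int en') →
      Set.Ico st' en' ⊆ Set.Ico c.st c.en →
      Eval M ddc stc (.limRange e₁ e₂ e₃) (.cap ⟨c.kind, st', en', 0⟩)

/-- An entry of the trusted control stack: the module of a suspended caller, its capability
registers, and the point where it resumes. -/
structure StackEntry where
  mid : ModID
  ddc : Cap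
  stc : Cap
  pcc : Cap

/-- Execution states. While a function of module `mid` runs, the start plus the offset of `stc` is
the base of its stack frame; for a suspended module, the start plus the offset of its capability in
`mstc` is the base of the next frame. -/
structure State where
  mem : Mem
  nalloc : ℤ
  stk : List StackEntry
  ddc : Cap
  stc : Cap
  pcc : Cap
  mstc : ModID → Option Cap

/-- In the state `s` of `P`, the function `f` of the module `m` executes its command `c`. -/
def Fetch (P : TProgram) (s : State) (m : TModule) (f : TFun) (c : Cmd TExp) : Prop :=
  P.HasFun m f ∧ s.pcc.kind = .κ ∧ s.pcc.st = f.codeCap.st ∧ s.pcc.en = f.codeCap.en ∧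
    0 ≤ s.pcc.off ∧ f.code[s.pcc.off.toNat]? = some c

/-- Evaluation in a state. -/
abbrev State.Eval (s : State) (e : TExp) (v : Val) : Prop := CapPtrs.Eval s.mem s.ddc s.stc e v

/-- The initial state of an executable program: static memory holds zeros, the heap and the stacks
are empty, and control is at the start of the entry point, whose frame fits in its stack. -/
def IsInit (P : TProgram) (s : State) : Prop :=
  ∃ m f, P.HasFun m f ∧ f.id = mainId ∧ m.stack.1 + f.frame ≤ m.stack.2 ∧
    s.pcc = f.codeCap ∧ s.ddc = m.dataCap ∧ s.stc = m.stackCap ∧ s.stk = [] ∧ s.nalloc = -1 ∧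
    (∀ a, (∃ I ∈ P.segments, a ∈ Set.Ico I.1 I.2) → s.mem a = some (.int 0)) ∧
    (∀ a, (∀ I ∈ P.segments, a ∉ Set.Ico I.1 I.2) → s.mem a = none) ∧
    (∀ m' ∈ P, s.mstc m'.id = some m'.stackCap) ∧
    (∀ mid, (∀ m' ∈ P, m'.id ≠ mid) → s.mstc mid = none)

/-- The memory `M` after zeroing the cells `[lo, hi)`. -/
noncomputable def Mem.zero (M : Mem) (lo hi : ℤ) : Mem :=
  fun a => if lo ≤ a ∧ a < hi then some (.int 0) else M a

/-- The memory `M` with a new stack frame of size `n` at `base`, that holds the arguments `vs`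
followed by zeros. -/
noncomputable def Mem.pushFrame (M : Mem) (base : ℤ) (n : ℕ) (vs : List Val) : Mem :=
  fun a => if base ≤ a ∧ a < base + n then some ((vs[(a - base).toNat]?).getD (.int 0)) else M a

/-- The small-step semantics, when the heap has at most `lim` cells. -/
inductive Step (lim : ℕ) (P : TProgram) : State → State → Prop
  | assign {s : State} {m : TModule} {f : TFun} {el er : TExp} {c : Cap} {a : ℤ} {v : Val} :
      Fetch P s m f (.assign el er) → s.Eval el (.cap c) → c.DataAt a → s.Eval er v →
      Step lim P s { s with mem := Function.update s.mem a (some v), pcc := s.pcc.inc 1 }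
  | alloc {s : State} {m : TModule} {f : TFun} {el en : TExp} {c : Cap} {a n : ℤ} :
      Fetch P s m f (.alloc el en) → s.Eval el (.cap c) → c.DataAt a →
      s.Eval en (.int n) → 0 < n → -1 - (s.nalloc - n) ≤ lim →
      Step lim P s
        { s with
          mem := Function.update (Mem.zero s.mem (s.nalloc - n + 1) (s.nalloc + 1)) a
            (some (.cap ⟨.δ, s.nalloc - n + 1, s.nalloc + 1, 0⟩))
          nalloc := s.nalloc - n
          pcc := s.pcc.inc 1 }
  | jumpZero {s : State} {m : TModule} {f : TFun} {ec eo : TExp} {z : ℤ} :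
      Fetch P s m f (.jumpIfZero ec eo) → s.Eval ec (.int 0) → s.Eval eo (.int z) →
      Step lim P s { s with pcc := s.pcc.inc z }
  | jumpNonzero {s : State} {m : TModule} {f : TFun} {ec eo : TExp} {v : Val} :
      Fetch P s m f (.jumpIfZero ec eo) → s.Eval ec v → v ≠ .int 0 →
      Step lim P s { s with pcc := s.pcc.inc 1 }
  | call {s : State} {m m' : TModule} {f f' : TFun} {fid : FunID} {es : List TExp}
      {vs : List Val} {mstc' : ModID → Option Cap} {stc' : Cap} :
      Fetch P s m f (.call fid es) → List.Forall₂ s.Eval es vs →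
      P.HasFun m' f' → f'.id = fid → vs.length = f'.nArgs →
      mstc' = Function.update s.mstc m.id (some (s.stc.inc f.frame)) →
      mstc' m'.id = some stc' → stc'.st + stc'.off + f'.frame ≤ stc'.en →
      Step lim P s
        { mem := Mem.pushFrame s.mem (stc'.st + stc'.off) f'.frame vs
          nalloc := s.nalloc
          stk := ⟨m.id, s.ddc, s.stc, s.pcc.inc 1⟩ :: s.stk
          ddc := m'.dataCap
          stc := stc'
          pcc := f'.codeCap
          mstc := mstc' }
  | ret {s : State} {m : TModule} {f : TFun} {k : StackEntry} {stk' : List StackEntry} :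
      Fetch P s m f .ret → s.stk = k :: stk' →
      Step lim P s
        { mem := s.mem
          nalloc := s.nalloc
          stk := stk'
          ddc := k.ddc
          stc := k.stc
          pcc := k.pcc
          mstc := Function.update s.mstc k.mid (some k.stc) }

/-- Terminal states: those that execute `exit`. -/
def Terminal (P : TProgram) (s : State) : Prop := ∃ m f, Fetch P s m f .exit

/-- Convergence of an executable program. -/
def Converges (lim : ℕ) (P : TProgram) : Prop :=
  ∃ s₀ s, IsInit P s₀ ∧ Relation.ReflTransGen (Step lim P) s₀ s ∧ Terminal P s

/-- Contextual equivalence: the two programs converge in the same contexts, among the contexts that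
complete each of them to an executable program. -/
def CtxEquiv (lim : ℕ) (p₁ p₂ : TProgram) : Prop :=
  ∀ C : TProgram, (link C p₁).Executable → (link C p₂).Executable →
    (Converges lim (link C p₁) ↔ Converges lim (link C p₂))

/-! ### Traces of partial target programs -/

/-- The direction of a border crossing: `input` (written `?`) from the context to the program,
`output` (written `!`) from the program to the context. -/
inductive Dir where
  | input | output

/-- Trace labels. -/
inductive Label where
  | tau
  | tick
  | ret (d : Dir) (mem : Mem) (nalloc : ℤ)
  | call (fid : FunID) (vs : List Val) (d : Dir) (mem : Mem) (nalloc : ℤ)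

/-- The addresses that can be reached in the memory `M` from those in `A`. -/
inductive Reach (A : Set ℤ) (M : Mem) : ℤ → Prop
  | base {a : ℤ} : a ∈ A → Reach A M a
  | next {a b : ℤ} {v : Val} : Reach A M a → M a = some v → b ∈ v.addrs → Reach A M b

/-- The set of the addresses that can be reached in the memory `M` from those in `A`. -/
def reachClosure (A : Set ℤ) (M : Mem) : Set ℤ := {a | Reach A M a}

open Classical in
/-- Restriction of a memory to a set of addresses. -/
noncomputable def Mem.restrict (M : Mem) (A : Set ℤ) : Mem := fun a => if a ∈ A then M a else none

/-- The control of the state `s` is in the program `p`. -/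
def InProg (p : TProgram) (s : State) : Prop := s.pcc.range ⊆ p.codeDom

/-- From `s` to `s'`, control crosses the border of `p` in the direction `d`. -/
def Crosses (p : TProgram) (s s' : State) : Dir → Prop
  | .input => ¬ InProg p s ∧ InProg p s'
  | .output => InProg p s ∧ ¬ InProg p s'

/-- Labeled steps of the whole program `P` with program of interest `p`. A trace state is an
execution state together with the set of the addresses shared so far. -/
inductive TraceStep (lim : ℕ) (P p : TProgram) :
    State × Set ℤ → Label → State × Set ℤ → Prop
  | tau {s s' : State} {σ : Set ℤ} :
      Step lim P s s' → (InProg p s ↔ InProg p s') →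
      TraceStep lim P p (s, σ) .tau (s', σ)
  | tick {s : State} {σ : Set ℤ} :
      Terminal P s → TraceStep lim P p (s, σ) .tick (s, σ)
  | ret {s s' : State} {σ σ' : Set ℤ} {m : TModule} {f : TFun} {d : Dir} :
      Step lim P s s' → Fetch P s m f .ret → Crosses p s s' d →
      σ' = reachClosure σ s'.mem →
      TraceStep lim P p (s, σ) (.ret d (s'.mem.restrict σ') s.nalloc) (s', σ')
  | call {s s' : State} {σ σ' : Set ℤ} {m : TModule} {f : TFun} {d : Dir} {fid : FunID}
      {es : List TExp} {vs : List Val} :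
      Step lim P s s' → Fetch P s m f (.call fid es) → List.Forall₂ s.Eval es vs →
      Crosses p s s' d →
      σ' = reachClosure (σ ∪ {a | ∃ v ∈ vs, a ∈ v.addrs}) s.mem →
      TraceStep lim P p (s, σ) (.call fid vs d (s.mem.restrict σ') s.nalloc) (s', σ')

/-- Finite sequences of labeled steps, with the list of their labels other than `τ`. -/
inductive Run (lim : ℕ) (P p : TProgram) : State × Set ℤ → List Label → State × Set ℤ → Prop
  | refl (x : State × Set ℤ) : Run lim P p x [] x
  | tau {x y z : State × Set ℤ} {α : List Label} :
      TraceStep lim P p x .tau y → Run lim P p y α z → Run lim P p x α z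
  | visible {x y z : State × Set ℤ} {l : Label} {α : List Label} :
      TraceStep lim P p x l y → l ≠ .tau → Run lim P p y α z → Run lim P p x (l :: α) z

/-- The set of the traces of a partial program. -/
def Tr (lim : ℕ) (p : TProgram) : Set (List Label) :=
  {α | ∃ (C : TProgram) (s₀ s : State) (σ : Set ℤ), (link C p).Executable ∧ IsInit (link C p) s₀ ∧
    Run lim (link C p) p (s₀, ∅) α (s, σ)}

/-- Trace equivalence. -/
def TraceEquiv (lim : ℕ) (p₁ p₂ : TProgram) : Prop := Tr lim p₁ = Tr lim p₂

/-! ### The compiler -/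

/-- Load-time information: the locations of the data segment and of the data stack of each module,
and the location of each function in the code memory. -/
structure Layout where
  data : ModID → ℤ × ℤ
  stack : ModID → ℤ × ℤ
  code : FunID → ℤ

/-- Addition of target expressions. -/
def TExp.add (e₁ e₂ : TExp) : TExp := .bin .add e₁ e₂

/-- Translation of `&x`, inside the function `f` of the module `m`. -/
def compileAddr (p : SProgram) (m : SModule) (f : SFun) (x : VarID) : Option TExp :=
  if x ∈ f.args ++ f.locals then do
    let b ← p.β x (some f.id) m.id
    let so := TExp.add (.startOf .getstc) (.offset .getstc)
    return .limRange .getstc (TExp.add (.int b.1) so) (TExp.add (.int b.2) so)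
  else if x ∈ m.vars then do
    let b ← p.β x none m.id
    return .limRange .getddc (TExp.add (.startOf .getddc) (.int b.1))
      (TExp.add (.startOf .getddc) (.int b.2))
  else none

mutual

/-- Translation of expressions, inside the function `f` of the module `m`. It is undefined on
expressions that take the address of something other than a variable in scope or a cell of an
array. -/
def compileExp (p : SProgram) (m : SModule) (f : SFun) : SExp → Option TExp
  | .int z => some (.int z)
  | .var x => do return .deref (← compileAddr p m f x)
  | .bin op e₁ e₂ => do return .bin op (← compileExp p m f e₁) (← compileExp p m f e₂)
  | .idx a i => do return .deref (.inc (← compileAmp p m f a) (← compileExp p m f i))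
  | .addrVar x => compileAddr p m f x
  | .addrIdx a i => do return .inc (← compileAmp p m f a) (← compileExp p m f i)
  | .deref e => do return .deref (← compileExp p m f e)
  | .startOf e => do return .startOf (← compileExp p m f e)
  | .endOf e => do return .endOf (← compileExp p m f e)
  | .offset e => do return .offset (← compileExp p m f e)
  | .capType e => do return .capType (← compileExp p m f e)
  | .limRange e₁ e₂ e₃ => do
      return .limRange (← compileExp p m f e₁) (← compileExp p m f e₂) (← compileExp p m f e₃)

/-- Translation of `&e`. -/
def compileAmp (p : SProgram) (m : SModule) (f : SFun) : SExp → Option TExp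
  | .var x => compileAddr p m f x
  | .idx a i => do return .inc (← compileAmp p m f a) (← compileExp p m f i)
  | _ => none

end

/-- Translation of commands. -/
def compileCmd (p : SProgram) (m : SModule) (f : SFun) : Cmd SExp → Option (Cmd TExp)
  | .assign el er => do return .assign (← compileExp p m f el) (← compileExp p m f er)
  | .alloc el en => do return .alloc (← compileExp p m f el) (← compileExp p m f en)
  | .call fid es => do return .call fid (← es.mapM (compileExp p m f))
  | .ret => some .ret
  | .jumpIfZero ec eo => do return .jumpIfZero (← compileExp p m f ec) (← compileExp p m f eo)
  | .exit => some .exit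

/-- The size of the stack frames of the function `f`: the least one that contains its arguments and
its local variables. -/
def frameSize (p : SProgram) (m : SModule) (f : SFun) : ℕ :=
  ((f.args ++ f.locals).map fun x => ((p.β x (some f.id) m.id).getD (0, 0)).2.toNat).foldr max 0

/-- Translation of functions. -/
def compileFun (L : Layout) (p : SProgram) (m : SModule) (f : SFun) : Option TFun := do
  return { id := f.id
           nArgs := f.args.length
           frame := frameSize p m f
           codeStart := L.code f.id
           code := ← f.body.mapM (compileCmd p m f) }

/-- Translation of modules. -/
def compileModule (L : Layout) (p : SProgram) (m : SModule) : Option TModule := do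
  return { id := m.id
           data := L.data m.id
           stack := L.stack m.id
           funs := ← m.funs.mapM (compileFun L p m) }

/-- The compiler. -/
def compile (L : Layout) (p : SProgram) : Option TProgram := p.modules.mapM (compileModule L p)

end CapPtrs

/-!
Suppose that `p₁` and `p₂` have the same traces and that the linked program `C[p₁]` converges. Its
execution has a trace that contains `✓` (`exists_run_tick`), which by assumption is also a trace of
`C'[p₂]` for some context `C'`. The executions of `C[p₁]` and of `C'[p₂]` are merged into a
converging execution of `C[p₂]` (`Run.merge`): it follows the former while the context executes, and
the latter while the program executes.

The merge works because capabilities cannot be forged. In each execution, every address is owned by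
one of the two linked parts: a static address by the part that declares it, a heap cell by the part
that allocates it. The part that executes reaches only addresses that it owns or that have been
shared (`Inv`, preserved by `Inv.step`, `Inv.cross_call` and `Inv.cross_ret`). So its silent steps
depend only on its own side of the state, and can be copied into the merged execution
(`AgreeActive.mimic`), and they do not change what is private to the other part
(`AgreePassive.step`). At a border crossing, the label fixes the arguments, the allocation pointer,
and the contents of all shared addresses; since shared addresses are always mapped, the label also
determines which addresses are shared (`Mem.restrict_inj`). Hence the part that resumes finds in the
merged execution what it finds in the execution that it has to follow from there on (`Merge.cross`).
The relation `SameStack` says that the interleaved control stack of the merged execution is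
consistent with those of the other two.

The two parts play symmetric roles, and the predicate `Linked` is symmetric, so that a single set of
lemmas covers both directions of a border crossing.
-/

namespace CapPtrs

/-! ### Linked programs and ownership of code -/

/-- The statically allocated addresses of a program. -/
def TProgram.static (P : TProgram) : Set ℤ := {a | ∃ I ∈ P.segments, a ∈ Set.Ico I.1 I.2}

/-- The whole program `P` consists of the two parts `X` and `Y`, which do not interfere. Unlike
`link`, this is symmetric in the two parts, so that every lemma about it serves both for the context
and for the program of interest. -/
structure Linked (P X Y : TProgram) : Prop where
  mem_iff : ∀ m, m ∈ P ↔ m ∈ X ∨ m ∈ Y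
  ids_ne : ∀ m ∈ X, ∀ m' ∈ Y, m.id ≠ m'.id
  fun_ids_ne : ∀ f ∈ X.funs, ∀ g ∈ Y.funs, f.id ≠ g.id
  static_disjoint : Disjoint X.static Y.static
  static_nonneg : ∀ a ∈ X.static ∪ Y.static, 0 ≤ a
  code_disjoint : ∀ f ∈ X.funs, ∀ g ∈ Y.funs, Disjoint f.codeCap.range g.codeCap.range
  code_nonempty : ∀ f ∈ P.funs, f.codeCap.range.Nonempty
  code_inj : ∀ f ∈ P.funs, ∀ g ∈ P.funs, f.codeCap.range = g.codeCap.range → f = g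

theorem TProgram.mem_funs {P : TProgram} {f : TFun} : f ∈ P.funs ↔ ∃ m ∈ P, f ∈ m.funs :=
  List.mem_flatMap

theorem TProgram.HasFun.mem_funs {P : TProgram} {m : TModule} {f : TFun} (h : P.HasFun m f) :
    f ∈ P.funs :=
  TProgram.mem_funs.2 ⟨m, h⟩

theorem TProgram.mem_segments {P : TProgram} {I : ℤ × ℤ} :
    I ∈ P.segments ↔ ∃ m ∈ P, I = m.data ∨ I = m.stack := by
  simp [TProgram.segments, List.mem_flatMap]

theorem TProgram.data_subset_static {P : TProgram} {m : TModule} (h : m ∈ P) :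
    m.dataCap.range ⊆ P.static :=
  fun _ ha => ⟨m.data, TProgram.mem_segments.2 ⟨m, h, .inl rfl⟩, ha⟩

theorem TProgram.stack_subset_static {P : TProgram} {m : TModule} (h : m ∈ P) :
    m.stackCap.range ⊆ P.static :=
  fun _ ha => ⟨m.stack, TProgram.mem_segments.2 ⟨m, h, .inr rfl⟩, ha⟩

theorem Linked.symm {P X Y : TProgram} (h : Linked P X Y) : Linked P Y X where
  mem_iff m := (h.mem_iff m).trans or_comm
  ids_ne m hm m' hm' := (h.ids_ne m' hm' m hm).symm
  fun_ids_ne f hf g hg := (h.fun_ids_ne g hg f hf).symm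
  static_disjoint := h.static_disjoint.symm
  static_nonneg a ha := h.static_nonneg a ha.symm
  code_disjoint f hf g hg := (h.code_disjoint g hg f hf).symm
  code_nonempty := h.code_nonempty
  code_inj := h.code_inj

theorem TProgram.funs_link (C p : TProgram) : (link C p).funs = C.funs ++ p.funs :=
  List.flatMap_append

theorem TProgram.segments_link (C p : TProgram) :
    (link C p).segments = C.segments ++ p.segments :=
  List.flatMap_append

theorem TProgram.static_link (C p : TProgram) : (link C p).static = C.static ∪ p.static := by
  ext a
  simp only [TProgram.static, TProgram.segments_link, List.mem_append, Set.mem_ofPred_eq,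
    Set.mem_union, or_and_right, exists_or]

theorem TProgram.Executable.linked {C p : TProgram} (h : (link C p).Executable) :
    Linked (link C p) C p where
  mem_iff _ := List.mem_append
  ids_ne m hm m' hm' e := by
    have := h.modules_nodup
    rw [link, List.map_append, List.nodup_append] at this
    exact this.2.2 _ (List.mem_map_of_mem hm) _ (List.mem_map_of_mem hm') e
  fun_ids_ne f hf g hg e := by
    have := h.funs_nodup
    rw [TProgram.funs_link, List.map_append, List.nodup_append] at this
    exact this.2.2 _ (List.mem_map_of_mem hf) _ (List.mem_map_of_mem hg) e
  static_disjoint := by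
    have := h.segments_disjoint
    rw [TProgram.segments_link, List.pairwise_append] at this
    rw [Set.disjoint_left]
    rintro a ⟨I, hI, haI⟩ ⟨J, hJ, haJ⟩
    exact Set.disjoint_left.1 (this.2.2 I hI J hJ) haI haJ
  static_nonneg a ha := by
    rw [← TProgram.static_link] at ha
    obtain ⟨I, hI, haI⟩ := ha
    exact (h.segments_nonneg I hI).1.trans haI.1
  code_disjoint f hf g hg := by
    have := h.code_disjoint
    rw [TProgram.funs_link, List.pairwise_append] at this
    exact this.2.2 f hf g hg
  code_nonempty f hf := by
    refine ⟨f.codeStart, le_refl _, ?_⟩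
    have := List.length_pos_of_ne_nil (h.code_ne f hf)
    simp only [TFun.codeCap]
    omega
  code_inj f hf g hg e := by
    by_contra hne
    have : Std.Symm fun f g : TFun => Disjoint f.codeCap.range g.codeCap.range :=
      ⟨fun _ _ hd => hd.symm⟩
    have hd : Disjoint f.codeCap.range g.codeCap.range := h.code_disjoint.forall hf hg hne
    rw [e, disjoint_self] at hd
    have := List.length_pos_of_ne_nil (h.code_ne g hg)
    have hm : g.codeStart ∈ g.codeCap.range := by
      refine ⟨le_refl _, ?_⟩
      simp only [TFun.codeCap]
      omega
    rw [hd] at hm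
    exact hm

/-- The capability `c` spans the code of a function of `X`. -/
def InCode (X : TProgram) (c : Cap) : Prop := ∃ f ∈ X.funs, c.range = f.codeCap.range

theorem Linked.mem_funs {P X Y : TProgram} (h : Linked P X Y) {f : TFun} :
    f ∈ P.funs ↔ f ∈ X.funs ∨ f ∈ Y.funs := by
  simp only [TProgram.mem_funs, h.mem_iff, or_and_right, exists_or]

theorem Linked.not_inCode {P X Y : TProgram} (h : Linked P X Y) {c : Cap} (hc : InCode X c) :
    ¬ InCode Y c := by
  obtain ⟨f, hf, ef⟩ := hc
  rintro ⟨g, hg, eg⟩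
  have hd := h.code_disjoint f hf g hg
  rw [← ef, ← eg, disjoint_self] at hd
  obtain ⟨a, ha⟩ := h.code_nonempty f (h.mem_funs.2 (.inl hf))
  rw [← ef, hd] at ha
  exact ha

theorem Linked.subset_codeDom_iff {P X Y : TProgram} (h : Linked P X Y) {c : Cap}
    (hc : InCode X c ∨ InCode Y c) : c.range ⊆ X.codeDom ↔ InCode X c := by
  constructor
  · intro hs
    refine hc.resolve_right ?_
    rintro ⟨g, hg, eg⟩
    obtain ⟨a, ha⟩ := h.code_nonempty g (h.mem_funs.2 (.inr hg))
    obtain ⟨f, hf, haf⟩ := hs (eg ▸ ha)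
    exact Set.disjoint_left.1 (h.code_disjoint f hf g hg) haf ha
  · rintro ⟨f, hf, ef⟩ a ha
    exact ⟨f, hf, ef ▸ ha⟩

theorem Fetch.range_eq {P : TProgram} {s : State} {m : TModule} {f : TFun} {c : Cmd TExp}
    (h : Fetch P s m f c) : s.pcc.range = f.codeCap.range := by
  rw [Cap.range, Cap.range, h.2.2.1, h.2.2.2.1]

/-- The module that executes in `s` belongs to the part that owns the program counter. -/
theorem Fetch.mem_part {P X Y : TProgram} (hL : Linked P X Y) {s : State} {m : TModule} {f : TFun}
    {c : Cmd TExp} (h : Fetch P s m f c) (hs : InCode X s.pcc) : m ∈ X :=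
  ((hL.mem_iff m).1 h.1.1).resolve_right fun hm =>
    hL.not_inCode hs ⟨f, TProgram.mem_funs.2 ⟨m, hm, h.1.2⟩, h.range_eq⟩

theorem Fetch.cmd_unique {P X Y : TProgram} (hL : Linked P X Y) {s : State} {m m' : TModule}
    {f f' : TFun} {c c' : Cmd TExp} (h : Fetch P s m f c) (h' : Fetch P s m' f' c') : c = c' := by
  obtain rfl := hL.code_inj f h.1.mem_funs f' h'.1.mem_funs (h.range_eq.symm.trans h'.range_eq)
  exact Option.some.inj (h.2.2.2.2.2.symm.trans h'.2.2.2.2.2)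

/-- A command of the part `X` is also fetched in any other program that contains `X`. -/
theorem Fetch.transfer {P P' X Y Y' : TProgram} (hL : Linked P X Y) (hL' : Linked P' X Y')
    {s s' : State} {m : TModule} {f : TFun} {c : Cmd TExp} (h : Fetch P s m f c)
    (hs : InCode X s.pcc) (e : s.pcc = s'.pcc) : Fetch P' s' m f c :=
  ⟨⟨(hL'.mem_iff m).2 (.inl (h.mem_part hL hs)), h.1.2⟩, e ▸ h.2⟩

/-! ### Evaluation with bounded authority -/

theorem Cap.DataAt.mem_addrs {c : Cap} {a : ℤ} (h : c.DataAt a) : a ∈ (Val.cap c).addrs :=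
  ⟨h.1, h.2.2⟩

/-- Capabilities cannot be forged: in a memory that is closed on the region `R`, evaluation from
registers that do not exceed `R` gives values that do not exceed `R`, and reads the memory on `R`
only. -/
theorem Eval.confined {M M' : Mem} {ddc stc : Cap} {e : TExp} {v : Val} {R : Set ℤ}
    (hM : ∀ a ∈ R, ∀ v, M a = some v → v.addrs ⊆ R) (hM' : ∀ a ∈ R, M a = M' a)
    (hd : (Val.cap ddc).addrs ⊆ R) (hs : (Val.cap stc).addrs ⊆ R) (h : Eval M ddc stc e v) :
    v.addrs ⊆ R ∧ Eval M' ddc stc e v := by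
  induction h with
  | int z => exact ⟨Set.empty_subset _, .int z⟩
  | getddc => exact ⟨hd, .getddc⟩
  | getstc => exact ⟨hs, .getstc⟩
  | bin _ _ ho ih₁ ih₂ => exact ⟨Set.empty_subset _, .bin ih₁.2 ih₂.2 ho⟩
  | inc _ _ ih₁ ih₂ => exact ⟨ih₁.1, .inc ih₁.2 ih₂.2⟩
  | deref _ ha hv ih =>
    have haR := ih.1 ha.mem_addrs
    exact ⟨hM _ haR _ hv, .deref ih.2 ha (hM' _ haR ▸ hv)⟩
  | startOf _ ih => exact ⟨Set.empty_subset _, .startOf ih.2⟩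
  | endOf _ ih => exact ⟨Set.empty_subset _, .endOf ih.2⟩
  | offset _ ih => exact ⟨Set.empty_subset _, .offset ih.2⟩
  | capTypeCode _ hk ih => exact ⟨Set.empty_subset _, .capTypeCode ih.2 hk⟩
  | capTypeData _ hk ih => exact ⟨Set.empty_subset _, .capTypeData ih.2 hk⟩
  | limRange _ _ _ hr ih₁ ih₂ ih₃ =>
    exact ⟨fun a ha => ih₁.1 ⟨ha.1, hr ha.2⟩, .limRange ih₁.2 ih₂.2 ih₃.2 hr⟩

theorem Eval.unique {M : Mem} {ddc stc : Cap} {e : TExp} {v w : Val} (h : Eval M ddc stc e v)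
    (h' : Eval M ddc stc e w) : v = w := by
  induction h generalizing w with
  | int z => cases h'; rfl
  | getddc => cases h'; rfl
  | getstc => cases h'; rfl
  | bin _ _ ho ih₁ ih₂ =>
    cases h' with
    | bin h₁ h₂ ho' =>
      cases ih₁ h₁; cases ih₂ h₂
      rw [ho] at ho'; cases ho'; rfl
  | inc _ _ ih₁ ih₂ => cases h' with | inc h₁ h₂ => cases ih₁ h₁; cases ih₂ h₂; rfl
  | deref _ ha hv ih =>
    cases h' with
    | deref h₁ ha' hv' =>
      cases ih h₁
      obtain rfl := ha.2.1.trans ha'.2.1.symm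
      exact Option.some.inj (hv.symm.trans hv')
  | startOf _ ih => cases h' with | startOf h₁ => cases ih h₁; rfl
  | endOf _ ih => cases h' with | endOf h₁ => cases ih h₁; rfl
  | offset _ ih => cases h' with | offset h₁ => cases ih h₁; rfl
  | capTypeCode _ hk ih =>
    cases h' with
    | capTypeCode h₁ hk' => rfl
    | capTypeData h₁ hk' => cases ih h₁; rw [hk] at hk'; cases hk'
  | capTypeData _ hk ih =>
    cases h' with
    | capTypeCode h₁ hk' => cases ih h₁; rw [hk] at hk'; cases hk'
    | capTypeData h₁ hk' => rfl
  | limRange _ _ _ hr ih₁ ih₂ ih₃ =>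
    cases h' with
    | limRange h₁ h₂ h₃ _ => cases ih₁ h₁; cases ih₂ h₂; cases ih₃ h₃; rfl

theorem Eval.unique_list {M : Mem} {ddc stc : Cap} {es : List TExp} {vs ws : List Val}
    (h : List.Forall₂ (Eval M ddc stc) es vs) (h' : List.Forall₂ (Eval M ddc stc) es ws) :
    vs = ws := by
  induction h generalizing ws with
  | nil => cases h'; rfl
  | cons h₁ _ ih => cases h' with | cons h₁' h₂' => rw [h₁.unique h₁', ih h₂']

theorem Mem.pushFrame_of_notMem {M : Mem} {base a : ℤ} {n : ℕ} {vs : List Val}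
    (h : ¬ (base ≤ a ∧ a < base + n)) : M.pushFrame base n vs a = M a := by
  simp [Mem.pushFrame, h]

theorem Mem.addrs_pushFrame {M : Mem} {base a : ℤ} {n : ℕ} {vs : List Val} {v : Val} {R : Set ℤ}
    (hvs : ∀ w ∈ vs, w.addrs ⊆ R) (h : base ≤ a ∧ a < base + n)
    (hv : M.pushFrame base n vs a = some v) : v.addrs ⊆ R := by
  simp only [Mem.pushFrame, h, and_self, if_true, Option.some.injEq] at hv
  subst hv
  cases hw : vs[(a - base).toNat]? with
  | none => exact Set.empty_subset _
  | some w => exact hvs w (List.mem_of_getElem? hw)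

theorem Mem.pushFrame_congr {M M' : Mem} {base a : ℤ} {n : ℕ} {vs : List Val} (h : M a = M' a) :
    M.pushFrame base n vs a = M'.pushFrame base n vs a := by
  simp only [Mem.pushFrame, h]

theorem Mem.pushFrame_ne_none {M : Mem} {base a : ℤ} {n : ℕ} {vs : List Val} (h : M a ≠ none) :
    M.pushFrame base n vs a ≠ none := by
  unfold Mem.pushFrame
  split_ifs <;> simp [h]

/-! ### The authority invariant -/

/-- `c` lies on the stack of a module of `X`, at a base that is not below the start of the stack. -/
def StackCap (X : TProgram) (c : Cap) : Prop := c.range ⊆ X.static ∧ 0 ≤ c.off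

/-- The entry `k` of the control stack suspends a function of `X`. -/
structure EntryOf (X : TProgram) (k : StackEntry) : Prop where
  mid : ∃ m ∈ X, m.id = k.mid
  pcc : InCode X k.pcc
  ddc : k.ddc.range ⊆ X.static
  stc : StackCap X k.stc

/-- The authority invariant of a state in which the part `X` executes and the part `Y` is
suspended. `A` and `B` are the addresses owned by `X` and by `Y`: their static addresses and the
heap cells that they allocated. `σ` is the set of the addresses shared so far. The part that executes
has authority over `A ∪ σ`, the suspended one over `B ∪ σ`. The cells of `σ` are at the disposal of
the part that executes: they can hold pointers to cells of `A` that are not shared yet, but none to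
private cells of `Y`. -/
structure Inv (X Y : TProgram) (A B σ : Set ℤ) (s : State) : Prop where
  pcc : InCode X s.pcc
  ddc : s.ddc.range ⊆ X.static
  stc : StackCap X s.stc
  mstc_active : ∀ m ∈ X, ∀ c, s.mstc m.id = some c → StackCap X c
  mstc_passive : ∀ m ∈ Y, ∀ c, s.mstc m.id = some c → StackCap Y c
  stk : ∀ k ∈ s.stk, EntryOf X k ∨ EntryOf Y k
  static_active : X.static ⊆ A
  static_passive : Y.static ⊆ B
  disjoint : Disjoint A B
  shared : σ ⊆ A ∪ B
  dom : ∀ a ∈ A ∪ B, s.mem a ≠ none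
  fresh : ∀ a ∈ A ∪ B, s.nalloc < a
  auth_active : ∀ a ∈ A ∪ σ, ∀ v, s.mem a = some v → v.addrs ⊆ A ∪ σ
  auth_passive : ∀ a ∈ B \ σ, ∀ v, s.mem a = some v → v.addrs ⊆ B ∪ σ

namespace Inv

variable {P X Y : TProgram} {A B σ : Set ℤ} {s t : State} {lim : ℕ}

theorem ddc_auth (h : Inv X Y A B σ s) : (Val.cap s.ddc).addrs ⊆ A ∪ σ :=
  fun _ ha => .inl (h.static_active (h.ddc ha.2))

theorem stc_auth (h : Inv X Y A B σ s) : (Val.cap s.stc).addrs ⊆ A ∪ σ :=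
  fun _ ha => .inl (h.static_active (h.stc.1 ha.2))

theorem eval_auth (h : Inv X Y A B σ s) {e : TExp} {v : Val} (he : s.Eval e v) :
    v.addrs ⊆ A ∪ σ :=
  (Eval.confined h.auth_active (fun _ _ => rfl) h.ddc_auth h.stc_auth he).1

theorem evals_auth (h : Inv X Y A B σ s) {es : List TExp} {vs : List Val}
    (he : List.Forall₂ s.Eval es vs) : ∀ v ∈ vs, v.addrs ⊆ A ∪ σ := by
  induction he with
  | nil => simp
  | cons h₁ _ ih =>
    intro v hv
    rcases List.mem_cons.1 hv with rfl | hv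
    · exact h.eval_auth h₁
    · exact ih v hv

theorem notMem_passive (h : Inv X Y A B σ s) {a : ℤ} (ha : a ∈ A ∪ σ) : a ∉ B \ σ :=
  fun hb => ha.elim (fun hA => Set.disjoint_left.1 h.disjoint hA hb.1) hb.2

theorem entry_of_inCode (hL : Linked P X Y) (h : Inv X Y A B σ s) {k : StackEntry}
    (hk : k ∈ s.stk) (hc : InCode X k.pcc) : EntryOf X k :=
  (h.stk k hk).resolve_right fun hY => hL.not_inCode hc hY.pcc

theorem inCode_of_step (hL : Linked P X Y) (h : Inv X Y A B σ s) (hs : Step lim P s t) :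
    InCode X t.pcc ∨ InCode Y t.pcc := by
  cases hs with
  | assign => exact .inl h.pcc
  | alloc => exact .inl h.pcc
  | jumpZero => exact .inl h.pcc
  | jumpNonzero => exact .inl h.pcc
  | call _ _ hf =>
    exact (hL.mem_funs.1 hf.mem_funs).imp (fun h => ⟨_, h, rfl⟩) (fun h => ⟨_, h, rfl⟩)
  | ret _ hk => exact (h.stk _ (hk ▸ List.mem_cons_self)).imp EntryOf.pcc EntryOf.pcc

end Inv

theorem StackCap.inc {X : TProgram} {c : Cap} (h : StackCap X c) (n : ℕ) :
    StackCap X (c.inc n) :=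
  ⟨h.1, add_nonneg h.2 (Int.natCast_nonneg n)⟩

theorem StackCap.frame_subset {X : TProgram} {c : Cap} (h : StackCap X c) {n : ℕ}
    (hn : c.st + c.off + n ≤ c.en) {a : ℤ} (ha : c.st + c.off ≤ a ∧ a < c.st + c.off + n) :
    a ∈ X.static :=
  h.1 ⟨by linarith [h.2, ha.1], by linarith [ha.2]⟩

theorem StackCap.update_mstc {X : TProgram} {mstc : ModID → Option Cap} {i : ModID} {c₀ : Cap}
    (h : ∀ m ∈ X, ∀ c, mstc m.id = some c → StackCap X c) (h₀ : StackCap X c₀) :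
    ∀ m ∈ X, ∀ c, Function.update mstc i (some c₀) m.id = some c → StackCap X c := by
  intro m hm c hc
  by_cases hi : m.id = i
  · subst hi
    rw [Function.update_self] at hc
    cases hc
    exact h₀
  · rw [Function.update_of_ne hi] at hc
    exact h m hm c hc

theorem update_mstc_of_foreign {P X Y : TProgram} (hL : Linked P X Y)
    {mstc : ModID → Option Cap} {m m' : TModule} {c : Option Cap} (hm : m ∈ X) (hm' : m' ∈ Y) :
    Function.update mstc m.id c m'.id = mstc m'.id :=
  Function.update_of_ne (hL.ids_ne m hm m' hm').symm _ _

namespace Inv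

variable {P X Y : TProgram} {A B σ : Set ℤ} {s t : State} {lim : ℕ}

/-- The authority invariant is preserved by the steps that stay in the part that executes; this part
becomes the owner of the cells that it allocates. -/
theorem step (hL : Linked P X Y) (h : Inv X Y A B σ s) (hs : Step lim P s t)
    (ht : InCode X t.pcc) : Inv X Y (A ∪ Set.Ioc t.nalloc s.nalloc) B σ t := by
  cases hs with
  | @assign m f el er c a v hf hl ha hr =>
    have haR := h.eval_auth hl ha.mem_addrs
    have hv := h.eval_auth hr
    simp only [Set.Ioc_self, Set.union_empty]
    exact
      { h with
        pcc := ht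
        dom := fun b hb => by
          by_cases hba : b = a
          · subst hba; simp
          · simpa [Function.update_of_ne hba] using h.dom b hb
        auth_active := fun b hb w hw => by
          by_cases hba : b = a
          · subst hba
            simp only [Function.update_self] at hw
            cases hw
            exact hv
          · simp only [Function.update_of_ne hba] at hw
            exact h.auth_active b hb w hw
        auth_passive := fun b hb w hw => by
          have hba : b ≠ a := fun e => h.notMem_passive haR (e ▸ hb)
          simp only [Function.update_of_ne hba] at hw
          exact h.auth_passive b hb w hw }
  | @alloc m f el en c a n hf hl ha hn hpos hlim =>
    have haR := h.eval_auth hl ha.mem_addrs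
    have hblock : ∀ b, s.nalloc - n + 1 ≤ b ∧ b < s.nalloc + 1 ↔
        b ∈ Set.Ioc (s.nalloc - n) s.nalloc := fun b => by
      simp only [Set.mem_Ioc]; omega
    -- The heap grows downward, so the new block lies below every owned address.
    have hnew : ∀ b ∈ A ∪ B, b ∉ Set.Ioc (s.nalloc - n) s.nalloc := fun b hb hb' =>
      absurd (h.fresh b hb) (not_lt.2 hb'.2)
    have hsub : A ∪ σ ⊆ A ∪ Set.Ioc (s.nalloc - n) s.nalloc ∪ σ := by
      intro b; simp only [Set.mem_union]; tauto
    exact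
      { h with
        pcc := ht
        static_active := h.static_active.trans Set.subset_union_left
        disjoint := Set.disjoint_union_left.2
          ⟨h.disjoint, Set.disjoint_right.2 fun b hb => hnew b (.inr hb)⟩
        shared := h.shared.trans (Set.union_subset_union_left _ Set.subset_union_left)
        dom := fun b hb => by
          by_cases hba : b = a
          · subst hba; simp
          · simp only [Function.update_of_ne hba, Mem.zero, hblock]
            split_ifs with hb'
            · simp
            · exact h.dom b (hb.imp_left fun hb => hb.resolve_right hb')
        fresh := fun b hb => by
          rcases hb with (hb | hb) | hb
          · have := h.fresh b (.inl hb)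
            simp only; omega
          · exact hb.1
          · have := h.fresh b (.inr hb)
            simp only; omega
        auth_active := fun b hb w hw => by
          by_cases hba : b = a
          · subst hba
            simp only [Function.update_self] at hw
            cases hw
            exact fun x hx => .inl (.inr ((hblock x).1 hx.2))
          · simp only [Function.update_of_ne hba, Mem.zero, hblock] at hw
            split_ifs at hw with hb'
            · cases hw; exact Set.empty_subset _
            · refine (h.auth_active b ?_ w hw).trans hsub
              exact hb.imp_left fun hb => hb.resolve_right hb'
        auth_passive := fun b hb w hw => by
          have hba : b ≠ a := fun e => h.notMem_passive haR (e ▸ hb)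
          simp only [Function.update_of_ne hba, Mem.zero, hblock,
            if_neg (hnew b (.inr hb.1))] at hw
          exact h.auth_passive b hb w hw }
  | jumpZero =>
    simp only [Set.Ioc_self, Set.union_empty]
    exact { h with pcc := ht }
  | jumpNonzero =>
    simp only [Set.Ioc_self, Set.union_empty]
    exact { h with pcc := ht }
  | @call m m' f f' fid es vs mstc' stc' hf he hf' hid hlen hm hst hfit =>
    have hmX := hf.mem_part hL h.pcc
    have hmX' : m' ∈ X := ((hL.mem_iff m').1 hf'.1).resolve_right fun hm =>
      hL.not_inCode ht ⟨f', TProgram.mem_funs.2 ⟨m', hm, hf'.2⟩, rfl⟩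
    have hms : ∀ m ∈ X, ∀ c, mstc' m.id = some c → StackCap X c := by
      subst hm
      exact StackCap.update_mstc h.mstc_active (h.stc.inc f.frame)
    have hframe := fun a ha => h.static_active ((hms m' hmX' _ hst).frame_subset hfit (a := a) ha)
    simp only [Set.Ioc_self, Set.union_empty]
    exact
      { h with
        pcc := ht
        ddc := TProgram.data_subset_static hmX'
        stc := hms m' hmX' _ hst
        mstc_active := hms
        mstc_passive := fun m₂ hm₂ c hc => by
          simp only [hm, update_mstc_of_foreign hL hmX hm₂] at hc
          exact h.mstc_passive m₂ hm₂ c hc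
        stk := fun k hk => by
          rcases List.mem_cons.1 hk with rfl | hk
          · exact .inl ⟨⟨m, hmX, rfl⟩, h.pcc, h.ddc, h.stc⟩
          · exact h.stk k hk
        dom := fun b hb => Mem.pushFrame_ne_none (h.dom b hb)
        auth_active := fun b hb w hw => by
          by_cases hb' : stc'.st + stc'.off ≤ b ∧ b < stc'.st + stc'.off + f'.frame
          · exact Mem.addrs_pushFrame (h.evals_auth he) hb' hw
          · simp only [Mem.pushFrame_of_notMem hb'] at hw
            exact h.auth_active b hb w hw
        auth_passive := fun b hb w hw => by
          simp only [Mem.pushFrame_of_notMem fun hb' =>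
            h.notMem_passive (.inl (hframe b hb')) hb] at hw
          exact h.auth_passive b hb w hw }
  | @ret m f k stk' hf hk =>
    have hkX := h.entry_of_inCode hL (hk ▸ List.mem_cons_self) ht
    simp only [Set.Ioc_self, Set.union_empty]
    exact
      { h with
        pcc := ht
        ddc := hkX.ddc
        stc := hkX.stc
        mstc_active := StackCap.update_mstc h.mstc_active hkX.stc
        mstc_passive := fun m₂ hm₂ c hc => by
          obtain ⟨m₁, hm₁, e⟩ := hkX.mid
          simp only [← e, update_mstc_of_foreign hL hm₁ hm₂] at hc
          exact h.mstc_passive m₂ hm₂ c hc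
        stk := fun k' hk' => h.stk k' (hk ▸ List.mem_cons_of_mem _ hk') }

end Inv

/-! ### Agreement of two states on a common part -/

/-- Two control stacks agree from the point of view of the part `X`, which executes (`true`) or is
suspended (`false`): the entries of `X` are the same, and are grouped in the same way by the
activations of foreign code in between, whose own entries are not compared. -/
inductive SameStack (X : TProgram) : Bool → List StackEntry → List StackEntry → Prop
  | nil (b : Bool) : SameStack X b [] []
  | own {k : StackEntry} {l l' : List StackEntry} :
      InCode X k.pcc → SameStack X true l l' → SameStack X true (k :: l) (k :: l')
  | foreignLeft {k : StackEntry} {l l' : List StackEntry} :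
      ¬ InCode X k.pcc → SameStack X false l l' → SameStack X false (k :: l) l'
  | foreignRight {k : StackEntry} {l l' : List StackEntry} :
      ¬ InCode X k.pcc → SameStack X false l l' → SameStack X false l (k :: l')
  | leave {k : StackEntry} {l l' : List StackEntry} :
      InCode X k.pcc → SameStack X true l l' → SameStack X false (k :: l) (k :: l')
  | enter {k k' : StackEntry} {l l' : List StackEntry} :
      ¬ InCode X k.pcc → ¬ InCode X k'.pcc → SameStack X false l l' →
      SameStack X true (k :: l) (k' :: l')

namespace SameStack

variable {X : TProgram} {b : Bool} {k k' : StackEntry} {l l' : List StackEntry}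

theorem symm (h : SameStack X b l l') : SameStack X b l' l := by
  induction h with
  | nil b => exact .nil b
  | own hk _ ih => exact .own hk ih
  | foreignLeft hk _ ih => exact .foreignRight hk ih
  | foreignRight hk _ ih => exact .foreignLeft hk ih
  | leave hk _ ih => exact .leave hk ih
  | enter hk hk' _ ih => exact .enter hk' hk ih

theorem pop_own (hk : InCode X k.pcc) (h : SameStack X true (k :: l) l') :
    ∃ l₁, l' = k :: l₁ ∧ SameStack X true l l₁ := by
  cases h with
  | own _ h => exact ⟨_, rfl, h⟩
  | enter hk' => exact absurd hk hk'

theorem pop_foreign (hk : ¬ InCode X k.pcc) (h : SameStack X false (k :: l) l') :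
    SameStack X false l l' := by
  generalize hl₀ : k :: l = l₀ at h
  generalize hb : false = b at h
  induction h with
  | nil => cases hl₀
  | own => cases hb
  | foreignLeft _ h => cases hl₀; exact h
  | foreignRight hk' _ ih => exact .foreignRight hk' (ih hl₀ hb)
  | leave hk' => cases hl₀; exact absurd hk' hk
  | enter => cases hb

theorem pop_enter (hk : ¬ InCode X k.pcc) (h : SameStack X true (k :: l) l') :
    ∃ k₁ l₁, l' = k₁ :: l₁ ∧ ¬ InCode X k₁.pcc ∧ SameStack X false l l₁ := by
  cases h with
  | own hk' => exact absurd hk' hk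
  | enter _ hk' h => exact ⟨_, _, rfl, hk', h⟩

theorem pop_leave (hk : InCode X k.pcc) (hk' : InCode X k'.pcc)
    (h : SameStack X false (k :: l) (k' :: l')) : k = k' ∧ SameStack X true l l' := by
  cases h with
  | foreignLeft h => exact absurd hk h
  | foreignRight h => exact absurd hk' h
  | leave _ h => exact ⟨rfl, h⟩

end SameStack

/-- Two states in which the part `X` executes look the same to `X`, which has authority over
`A ∪ σ`. -/
structure AgreeActive (X : TProgram) (A σ : Set ℤ) (s s' : State) : Prop where
  mem : ∀ a ∈ A ∪ σ, s.mem a = s'.mem a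
  nalloc : s.nalloc = s'.nalloc
  ddc : s.ddc = s'.ddc
  stc : s.stc = s'.stc
  pcc : s.pcc = s'.pcc
  mstc : ∀ m ∈ X, s.mstc m.id = s'.mstc m.id
  stk : SameStack X true s.stk s'.stk

/-- Two states in which the part `X` is suspended agree on what is private to `X`, which owns
`A`. -/
structure AgreePassive (X : TProgram) (A σ : Set ℤ) (s s' : State) : Prop where
  mem : ∀ a ∈ A \ σ, s.mem a = s'.mem a
  mstc : ∀ m ∈ X, s.mstc m.id = s'.mstc m.id
  stk : SameStack X false s.stk s'.stk

theorem AgreePassive.symm {X : TProgram} {A σ : Set ℤ} {s s' : State}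
    (h : AgreePassive X A σ s s') : AgreePassive X A σ s' s where
  mem a ha := (h.mem a ha).symm
  mstc m hm := (h.mstc m hm).symm
  stk := h.stk.symm

theorem AgreeActive.eval {X Z : TProgram} {A B σ : Set ℤ} {s s' : State}
    (ha : AgreeActive X A σ s s') (h : Inv X Z A B σ s) {e : TExp} {v : Val} (he : s.Eval e v) :
    s'.Eval e v := by
  have := (Eval.confined h.auth_active ha.mem h.ddc_auth h.stc_auth he).2
  rwa [ha.ddc, ha.stc] at this

/-- A step that stays in the part `X` can be taken in any state that looks the same to `X`, of any
program that contains `X`. -/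
theorem AgreeActive.mimic {P P' X Z Y : TProgram} {A B σ : Set ℤ} {s t s' : State} {lim : ℕ}
    (hL : Linked P X Z) (hL' : Linked P' X Y) (h : Inv X Z A B σ s) (hs : Step lim P s t)
    (ht : InCode X t.pcc) (ha : AgreeActive X A σ s s') :
    ∃ t', Step lim P' s' t' ∧ AgreeActive X (A ∪ Set.Ioc t.nalloc s.nalloc) σ t t' := by
  have hev : ∀ {e v}, s.Eval e v → s'.Eval e v := fun he => ha.eval h he
  have hfetch : ∀ {m f c}, Fetch P s m f c → Fetch P' s' m f c :=
    fun hf => hf.transfer hL hL' h.pcc ha.pcc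
  cases hs with
  | @assign m f el er c a v hf hl hc hr =>
    refine ⟨_, .assign (hfetch hf) (hev hl) hc (hev hr), ?_⟩
    simp only [Set.Ioc_self, Set.union_empty]
    exact
      { ha with
        mem := fun b hb => by simp only [Function.update_apply, ha.mem b hb]
        pcc := by simp only [ha.pcc] }
  | @alloc m f el en c a n hf hl hc hn hpos hlim =>
    refine ⟨_, .alloc (hfetch hf) (hev hl) hc (hev hn) hpos (ha.nalloc ▸ hlim), ?_⟩
    exact
      { ha with
        mem := fun b hb => by
          simp only [← ha.nalloc, Function.update_apply, Mem.zero]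
          split_ifs with h₁ h₂
          · rfl
          · rfl
          · refine ha.mem b (hb.imp_left fun hb => hb.resolve_right fun hb => h₂ ?_)
            have := hb.1
            have := hb.2
            simp only at *
            omega
        nalloc := by simp only [ha.nalloc]
        pcc := by simp only [ha.pcc] }
  | jumpZero hf hc ho =>
    refine ⟨_, .jumpZero (hfetch hf) (hev hc) (hev ho), ?_⟩
    simp only [Set.Ioc_self, Set.union_empty]
    exact { ha with pcc := by simp only [ha.pcc] }
  | jumpNonzero hf hc ho =>
    refine ⟨_, .jumpNonzero (hfetch hf) (hev hc) ho, ?_⟩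
    simp only [Set.Ioc_self, Set.union_empty]
    exact { ha with pcc := by simp only [ha.pcc] }
  | @call m m' f f' fid es vs mstc' stc' hf he hf' hid hlen hm hst hfit =>
    have hmX' : m' ∈ X := ((hL.mem_iff m').1 hf'.1).resolve_right fun hm =>
      hL.not_inCode ht ⟨f', TProgram.mem_funs.2 ⟨m', hm, hf'.2⟩, rfl⟩
    have hms : ∀ m₁ ∈ X, mstc' m₁.id =
        Function.update s'.mstc m.id (some (s'.stc.inc f.frame)) m₁.id := fun m₁ hm₁ => by
      rw [hm, ← ha.stc, Function.update_apply, Function.update_apply, ha.mstc m₁ hm₁]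
    refine ⟨_, .call (hfetch hf) (he.imp fun _ _ => hev) ⟨(hL'.mem_iff _).2 (.inl hmX'), hf'.2⟩ hid
      hlen rfl ((hms m' hmX').symm.trans hst) hfit, ?_⟩
    simp only [Set.Ioc_self, Set.union_empty]
    exact
      { mem := fun b hb => Mem.pushFrame_congr (ha.mem b hb)
        nalloc := ha.nalloc
        ddc := rfl
        stc := rfl
        pcc := rfl
        mstc := hms
        stk := by
          simp only [← ha.ddc, ← ha.stc, ← ha.pcc]
          exact .own h.pcc ha.stk }
  | @ret m f k stk' hf hk =>
    obtain ⟨l, hl, hsame⟩ := (hk ▸ ha.stk).pop_own ht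
    refine ⟨_, .ret (hfetch hf) hl, ?_⟩
    simp only [Set.Ioc_self, Set.union_empty]
    exact
      { mem := ha.mem
        nalloc := ha.nalloc
        ddc := rfl
        stc := rfl
        pcc := rfl
        mstc := fun m₁ hm₁ => by
          simp only [Function.update_apply, ha.mstc m₁ hm₁]
        stk := hsame }

/-- What is private to a suspended part does not change while the other part executes. -/
theorem AgreePassive.step {P X Y : TProgram} {A B σ : Set ℤ} {s t s' : State} {lim : ℕ}
    (hL : Linked P X Y) (h : Inv X Y A B σ s) (hs : Step lim P s t) (ht : InCode X t.pcc)
    (ha : AgreePassive Y B σ s s') : AgreePassive Y B σ t s' := by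
  have hnot : ∀ {k : StackEntry}, InCode X k.pcc → ¬ InCode Y k.pcc := hL.not_inCode
  cases hs with
  | @assign m f el er c a v hf hl hc hr =>
    have haR := h.eval_auth hl hc.mem_addrs
    exact
      { ha with
        mem := fun b hb => by
          have hba : b ≠ a := fun e => h.notMem_passive haR (e ▸ hb)
          simp only [Function.update_of_ne hba, ha.mem b hb] }
  | @alloc m f el en c a n hf hl hc hn hpos hlim =>
    have haR := h.eval_auth hl hc.mem_addrs
    exact
      { ha with
        mem := fun b hb => by
          have hba : b ≠ a := fun e => h.notMem_passive haR (e ▸ hb)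
          have := h.fresh b (.inr hb.1)
          have hb' : ¬ (s.nalloc - n + 1 ≤ b ∧ b < s.nalloc + 1) := by omega
          simp only [Function.update_of_ne hba, Mem.zero, hb', if_false, ha.mem b hb] }
  | jumpZero => exact ⟨ha.mem, ha.mstc, ha.stk⟩
  | jumpNonzero => exact ⟨ha.mem, ha.mstc, ha.stk⟩
  | @call m m' f f' fid es vs mstc' stc' hf he hf' hid hlen hm hst hfit =>
    have hmX := hf.mem_part hL h.pcc
    have hstc : StackCap X stc' := (h.step hL
      (.call (lim := lim) hf he hf' hid hlen hm hst hfit) ht).stc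
    exact
      { mem := fun b hb => by
          have hb' := fun hb' => h.notMem_passive
            (.inl (h.static_active (hstc.frame_subset hfit (a := b) hb'))) hb
          simp only [Mem.pushFrame_of_notMem hb', ha.mem b hb]
        mstc := fun m₁ hm₁ => by
          simp only [hm, update_mstc_of_foreign hL hmX hm₁, ha.mstc m₁ hm₁]
        stk := .foreignLeft (hnot h.pcc) ha.stk }
  | @ret m f k stk' hf hk =>
    obtain ⟨m₀, hm₀, e⟩ := (h.entry_of_inCode hL (hk ▸ List.mem_cons_self) ht).mid
    exact
      { mem := ha.mem
        mstc := fun m₁ hm₁ => by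
          simp only [← e, update_mstc_of_foreign hL hm₀ hm₁, ha.mstc m₁ hm₁]
        stk := (hk ▸ ha.stk).pop_foreign (hnot ht) }

/-! ### Border crossings -/

theorem subset_reachClosure (A : Set ℤ) (M : Mem) : A ⊆ reachClosure A M := fun _ => .base

theorem addrs_subset_reachClosure {A : Set ℤ} {M : Mem} {a : ℤ} {v : Val}
    (ha : a ∈ reachClosure A M) (hv : M a = some v) : v.addrs ⊆ reachClosure A M :=
  fun _ hb => .next ha hv hb

theorem reachClosure_subset {A R : Set ℤ} {M : Mem} (hA : A ⊆ R)
    (hM : ∀ a ∈ R, ∀ v, M a = some v → v.addrs ⊆ R) : reachClosure A M ⊆ R := by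
  intro a ha
  induction ha with
  | base h => exact hA h
  | next _ hv hb ih => exact hM _ ih _ hv hb

/-- Since a shared memory is mapped everywhere, it determines the set of the shared addresses. -/
theorem Mem.restrict_inj {M M' : Mem} {S S' : Set ℤ} (hS : ∀ a ∈ S, M a ≠ none)
    (hS' : ∀ a ∈ S', M' a ≠ none) (h : M.restrict S = M'.restrict S') :
    S = S' ∧ ∀ a ∈ S, M a = M' a := by
  have hp := fun a => congrFun h a
  simp only [Mem.restrict] at hp
  have e : S = S' := by
    ext a
    have := hp a
    constructor
    · intro ha
      by_contra hb
      rw [if_pos ha, if_neg hb] at this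
      exact hS a ha this
    · intro ha
      by_contra hb
      rw [if_neg hb, if_pos ha] at this
      exact hS' a ha this.symm
  subst e
  exact ⟨rfl, fun a ha => by simpa [ha] using hp a⟩

/-- The steps of `Step` that call `fid` with the arguments `vs`. -/
inductive CallStep (P : TProgram) (s : State) (fid : FunID) (vs : List Val) : State → Prop
  | mk {m m' : TModule} {f f' : TFun} {es : List TExp} {stc' : Cap} :
      Fetch P s m f (.call fid es) → List.Forall₂ s.Eval es vs → P.HasFun m' f' → f'.id = fid →
      vs.length = f'.nArgs →
      Function.update s.mstc m.id (some (s.stc.inc f.frame)) m'.id = some stc' →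
      stc'.st + stc'.off + f'.frame ≤ stc'.en →
      CallStep P s fid vs
        { mem := Mem.pushFrame s.mem (stc'.st + stc'.off) f'.frame vs
          nalloc := s.nalloc
          stk := ⟨m.id, s.ddc, s.stc, s.pcc.inc 1⟩ :: s.stk
          ddc := m'.dataCap
          stc := stc'
          pcc := f'.codeCap
          mstc := Function.update s.mstc m.id (some (s.stc.inc f.frame)) }

/-- The steps of `Step` that return. -/
inductive RetStep (P : TProgram) (s : State) : State → Prop
  | mk {m : TModule} {f : TFun} {k : StackEntry} {stk' : List StackEntry} :
      Fetch P s m f .ret → s.stk = k :: stk' →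
      RetStep P s
        { mem := s.mem
          nalloc := s.nalloc
          stk := stk'
          ddc := k.ddc
          stc := k.stc
          pcc := k.pcc
          mstc := Function.update s.mstc k.mid (some k.stc) }

section Inversion

variable {P X Y : TProgram} {lim : ℕ} {s t : State} {m : TModule} {f : TFun}

theorem Step.callStep (hL : Linked P X Y) {fid : FunID} {es : List TExp} {vs : List Val}
    (hs : Step lim P s t) (hf : Fetch P s m f (.call fid es)) (he : List.Forall₂ s.Eval es vs) :
    CallStep P s fid vs t := by
  cases hs with
  | assign hf' => cases hf.cmd_unique hL hf'
  | alloc hf' => cases hf.cmd_unique hL hf'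
  | jumpZero hf' => cases hf.cmd_unique hL hf'
  | jumpNonzero hf' => cases hf.cmd_unique hL hf'
  | ret hf' => cases hf.cmd_unique hL hf'
  | call hf' he' hg hid hlen hm hst hfit =>
    cases hf.cmd_unique hL hf'
    cases Eval.unique_list he he'
    subst hm
    exact .mk hf' he' hg hid hlen hst hfit

theorem Step.retStep (hL : Linked P X Y) (hs : Step lim P s t) (hf : Fetch P s m f .ret) :
    RetStep P s t := by
  cases hs with
  | assign hf' => cases hf.cmd_unique hL hf'
  | alloc hf' => cases hf.cmd_unique hL hf'
  | jumpZero hf' => cases hf.cmd_unique hL hf'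
  | jumpNonzero hf' => cases hf.cmd_unique hL hf'
  | ret hf' hk => exact .mk hf' hk
  | call hf' => cases hf.cmd_unique hL hf'

theorem CallStep.step {fid : FunID} {vs : List Val} (h : CallStep P s fid vs t) :
    Step lim P s t := by
  cases h with
  | mk hf he hg hid hlen hst hfit => exact .call hf he hg hid hlen rfl hst hfit

theorem RetStep.step (h : RetStep P s t) : Step lim P s t := by
  cases h with
  | mk hf hk => exact .ret hf hk

end Inversion

namespace Inv

variable {P X Y : TProgram} {A B σ S : Set ℤ} {s t : State}

theorem reachClosure_subset_auth (h : Inv X Y A B σ s) (hS : S ⊆ A ∪ σ) :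
    reachClosure S s.mem ⊆ A ∪ σ :=
  reachClosure_subset hS h.auth_active

theorem reachClosure_subset_owned (h : Inv X Y A B σ s) (hS : S ⊆ A ∪ σ) :
    reachClosure S s.mem ⊆ B ∪ A :=
  (h.reachClosure_subset_auth hS).trans
    (Set.union_comm A B ▸ Set.union_subset Set.subset_union_left h.shared)

/-- Once the addresses reachable from the shared ones are shared, the suspended part can resume. -/
theorem resume_auth (h : Inv X Y A B σ s) (hσ : σ ⊆ S) :
    ∀ a ∈ B ∪ reachClosure S s.mem, ∀ v, s.mem a = some v →
      v.addrs ⊆ B ∪ reachClosure S s.mem := by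
  intro a ha v hv
  by_cases hS : a ∈ reachClosure S s.mem
  · exact (addrs_subset_reachClosure hS hv).trans Set.subset_union_right
  · have hσ' := hσ.trans (subset_reachClosure S s.mem)
    exact (h.auth_passive a ⟨ha.resolve_right hS, fun h => hS (hσ' h)⟩ v hv).trans
      (Set.union_subset_union_right _ hσ')

theorem suspend_auth (h : Inv X Y A B σ s) (hσ : σ ⊆ S) :
    ∀ a ∈ A \ reachClosure S s.mem, ∀ v, s.mem a = some v →
      v.addrs ⊆ A ∪ reachClosure S s.mem := fun a ha v hv =>
  (h.auth_active a (.inl ha.1) v hv).trans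
    (Set.union_subset_union_right _ (hσ.trans (subset_reachClosure S s.mem)))

theorem args_auth (h : Inv X Y A B σ s) {fid : FunID} {vs : List Val}
    (hc : CallStep P s fid vs t) : σ ∪ {a | ∃ v ∈ vs, a ∈ v.addrs} ⊆ A ∪ σ := by
  cases hc with
  | mk _ he => exact Set.union_subset Set.subset_union_right fun a ⟨v, hv, ha⟩ =>
      h.evals_auth he v hv ha

/-- A call that crosses the border exchanges the roles of the two parts. -/
theorem cross_call (hL : Linked P X Y) (h : Inv X Y A B σ s) {fid : FunID} {vs : List Val}
    (hc : CallStep P s fid vs t) (ht : InCode Y t.pcc) :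
    Inv Y X B A (reachClosure (σ ∪ {a | ∃ v ∈ vs, a ∈ v.addrs}) s.mem) t := by
  have hS := h.args_auth hc
  have hσ : σ ⊆ σ ∪ {a | ∃ v ∈ vs, a ∈ v.addrs} := Set.subset_union_left
  have hvs : ∀ v ∈ vs, v.addrs ⊆ reachClosure (σ ∪ {a | ∃ v ∈ vs, a ∈ v.addrs}) s.mem :=
    fun v hv a ha => .base (.inr ⟨v, hv, ha⟩)
  generalize σ ∪ {a | ∃ v ∈ vs, a ∈ v.addrs} = S at *
  cases hc with
  | @mk m m' f f' es stc' hf he hf' hid hlen hst hfit =>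
    have hmX := hf.mem_part hL h.pcc
    have hmY : m' ∈ Y := ((hL.mem_iff m').1 hf'.1).resolve_left fun hm =>
      hL.not_inCode ⟨f', TProgram.mem_funs.2 ⟨m', hm, hf'.2⟩, rfl⟩ ht
    have hstc : StackCap Y stc' :=
      h.mstc_passive m' hmY _ (by rwa [update_mstc_of_foreign hL hmX hmY] at hst)
    have hframe := fun a ha => h.static_passive (hstc.frame_subset hfit (a := a) ha)
    exact
      { pcc := ht
        ddc := TProgram.data_subset_static hmY
        stc := hstc
        mstc_active := fun m₁ hm₁ c hc => by
          simp only [update_mstc_of_foreign hL hmX hm₁] at hc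
          exact h.mstc_passive m₁ hm₁ c hc
        mstc_passive := StackCap.update_mstc h.mstc_active (h.stc.inc f.frame)
        stk := fun k hk => by
          rcases List.mem_cons.1 hk with rfl | hk
          · exact .inr ⟨⟨m, hmX, rfl⟩, h.pcc, h.ddc, h.stc⟩
          · exact (h.stk k hk).symm
        static_active := h.static_passive
        static_passive := h.static_active
        disjoint := h.disjoint.symm
        shared := h.reachClosure_subset_owned hS
        dom := fun b hb => Mem.pushFrame_ne_none (h.dom b hb.symm)
        fresh := fun b hb => h.fresh b hb.symm
        auth_active := fun b hb w hw => by
          by_cases hb' : stc'.st + stc'.off ≤ b ∧ b < stc'.st + stc'.off + f'.frame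
          · exact (Mem.addrs_pushFrame hvs hb' hw).trans Set.subset_union_right
          · simp only [Mem.pushFrame_of_notMem hb'] at hw
            exact h.resume_auth hσ b hb w hw
        auth_passive := fun b hb w hw => by
          simp only [Mem.pushFrame_of_notMem fun hb' =>
            Set.disjoint_left.1 h.disjoint hb.1 (hframe b hb')] at hw
          exact h.suspend_auth hσ b hb w hw }

/-- A return that crosses the border exchanges the roles of the two parts. -/
theorem cross_ret (hL : Linked P X Y) (h : Inv X Y A B σ s) (hr : RetStep P s t)
    (ht : InCode Y t.pcc) : Inv Y X B A (reachClosure σ s.mem) t := by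
  cases hr with
  | @mk m f k stk' hf hk =>
    have hkY : EntryOf Y k := (h.stk k (hk ▸ List.mem_cons_self)).resolve_left fun hX =>
      hL.not_inCode hX.pcc ht
    exact
      { pcc := ht
        ddc := hkY.ddc
        stc := hkY.stc
        mstc_active := StackCap.update_mstc h.mstc_passive hkY.stc
        mstc_passive := fun m₁ hm₁ c hc => by
          obtain ⟨m₀, hm₀, e⟩ := hkY.mid
          simp only [← e, update_mstc_of_foreign hL.symm hm₀ hm₁] at hc
          exact h.mstc_active m₁ hm₁ c hc
        stk := fun k' hk' => (h.stk k' (hk ▸ List.mem_cons_of_mem _ hk')).symm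
        static_active := h.static_passive
        static_passive := h.static_active
        disjoint := h.disjoint.symm
        shared := h.reachClosure_subset_owned Set.subset_union_right
        dom := fun b hb => h.dom b hb.symm
        fresh := fun b hb => h.fresh b hb.symm
        auth_active := h.resume_auth subset_rfl
        auth_passive := h.suspend_auth subset_rfl }

end Inv

theorem reachClosure_congr {S R : Set ℤ} {M M' : Mem} (hS : S ⊆ R)
    (hM : ∀ a ∈ R, ∀ v, M a = some v → v.addrs ⊆ R) (hMM' : ∀ a ∈ R, M a = M' a) :
    reachClosure S M = reachClosure S M' := by
  have key : ∀ {M M' : Mem}, (∀ a ∈ R, ∀ v, M a = some v → v.addrs ⊆ R) →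
      (∀ a ∈ R, M a = M' a) → reachClosure S M ⊆ reachClosure S M' := by
    intro M M' hM hMM' a ha
    have hR := reachClosure_subset hS hM
    induction ha with
    | base h => exact .base h
    | next h hv hb ih => exact .next ih (hMM' _ (hR h) ▸ hv) hb
  refine (key hM hMM').antisymm (key (fun a ha v hv => ?_) fun a ha => (hMM' a ha).symm)
  exact hM a ha v ((hMM' a ha).trans hv)

/-! ### Merging two executions into a third one -/

/-- The state `s₃` of `X` linked with `Y` is the merge of the state `s₁` of `X` linked with `Z` and
of the state `s₂` of `W` linked with `Y`, while `X` executes in `s₁` and `s₃`, and `W` in `s₂`: it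
has the `X`-side of `s₁` and the `Y`-side of `s₂`. -/
structure Merge (X Z Y W : TProgram) (A AZ B AW σ : Set ℤ) (s₁ s₂ s₃ : State) : Prop where
  inv₁ : Inv X Z A AZ σ s₁
  inv₂ : Inv W Y AW B σ s₂
  inv₃ : Inv X Y A B σ s₃
  active : AgreeActive X A σ s₁ s₃
  passive : AgreePassive Y B σ s₂ s₃

namespace Merge

variable {P₁ P₂ P₃ X Z Y W : TProgram} {A AZ B AW σ : Set ℤ} {s₁ s₂ s₃ t₁ t₂ : State} {lim : ℕ}

theorem step_active (hL₁ : Linked P₁ X Z) (hL₃ : Linked P₃ X Y)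
    (h : Merge X Z Y W A AZ B AW σ s₁ s₂ s₃) (hs : Step lim P₁ s₁ t₁) (ht : InCode X t₁.pcc) :
    ∃ A' t₃, Step lim P₃ s₃ t₃ ∧ Merge X Z Y W A' AZ B AW σ t₁ s₂ t₃ := by
  obtain ⟨t₃, hs₃, ha⟩ := h.active.mimic hL₁ hL₃ h.inv₁ hs ht
  have ht₃ : InCode X t₃.pcc := ha.pcc ▸ ht
  refine ⟨_, t₃, hs₃, h.inv₁.step hL₁ hs ht, h.inv₂, ?_, ha,
    (h.passive.symm.step hL₃ h.inv₃ hs₃ ht₃).symm⟩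
  rw [ha.nalloc, h.active.nalloc]
  exact h.inv₃.step hL₃ hs₃ ht₃

theorem step_passive (hL₂ : Linked P₂ W Y) (h : Merge X Z Y W A AZ B AW σ s₁ s₂ s₃)
    (hs : Step lim P₂ s₂ t₂) (ht : InCode W t₂.pcc) :
    ∃ AW', Merge X Z Y W A AZ B AW' σ s₁ t₂ s₃ :=
  ⟨_, h.inv₁, h.inv₂.step hL₂ hs ht, h.inv₃, h.active, h.passive.step hL₂ h.inv₂ hs ht⟩

theorem terminal (hL₁ : Linked P₁ X Z) (hL₃ : Linked P₃ X Y)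
    (h : Merge X Z Y W A AZ B AW σ s₁ s₂ s₃) (ht : Terminal P₁ s₁) : Terminal P₃ s₃ := by
  obtain ⟨m, f, hf⟩ := ht
  exact ⟨m, f, hf.transfer hL₁ hL₃ h.inv₁.pcc h.active.pcc⟩

/-- If the two executions share the same memory on the addresses reachable from `S`, these addresses
and their contents are the same in the three states. -/
theorem shared_eq (h : Merge X Z Y W A AZ B AW σ s₁ s₂ s₃) {S : Set ℤ} (hS₁ : S ⊆ A ∪ σ)
    (hS₂ : S ⊆ AW ∪ σ)
    (hmem : s₁.mem.restrict (reachClosure S s₁.mem) = s₂.mem.restrict (reachClosure S s₂.mem)) :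
    reachClosure S s₁.mem = reachClosure S s₂.mem ∧
      reachClosure S s₁.mem = reachClosure S s₃.mem ∧
      ∀ a ∈ reachClosure S s₂.mem, s₂.mem a = s₃.mem a := by
  obtain ⟨e, hm⟩ := Mem.restrict_inj
    (fun a ha => h.inv₁.dom a (h.inv₁.reachClosure_subset_owned hS₁ ha).symm)
    (fun a ha => h.inv₂.dom a (h.inv₂.reachClosure_subset_owned hS₂ ha).symm) hmem
  refine ⟨e, reachClosure_congr hS₁ h.inv₁.auth_active h.active.mem, fun a ha => ?_⟩
  rw [← e] at ha
  exact (hm a ha).symm.trans (h.active.mem a (h.inv₁.reachClosure_subset_auth hS₁ ha))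

/-- After the shared memory has been synchronized, the memories of the second and the third
execution agree on everything that `Y` has authority over. -/
theorem resume_mem (h : Merge X Z Y W A AZ B AW σ s₁ s₂ s₃) {σ' : Set ℤ} (hσ : σ ⊆ σ')
    (hm : ∀ a ∈ σ', s₂.mem a = s₃.mem a) : ∀ a ∈ B ∪ σ', s₂.mem a = s₃.mem a := by
  intro a ha
  by_cases h' : a ∈ σ'
  · exact hm a h'
  · exact h.passive.mem a ⟨ha.resolve_right h', fun h₀ => h' (hσ h₀)⟩

/-- When the first two executions make the same call across the border, so does the third one: the
caller acts as in the first execution, and the callee starts as in the second one. -/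
theorem cross_call (hL₁ : Linked P₁ X Z) (hL₂ : Linked P₂ W Y) (hL₃ : Linked P₃ X Y)
    (h : Merge X Z Y W A AZ B AW σ s₁ s₂ s₃) {fid : FunID} {vs : List Val} {σ₁ σ₂ : Set ℤ}
    (hc₁ : CallStep P₁ s₁ fid vs t₁) (ht₁ : InCode Z t₁.pcc)
    (hc₂ : CallStep P₂ s₂ fid vs t₂) (ht₂ : InCode Y t₂.pcc)
    (hσ₁ : σ₁ = reachClosure (σ ∪ {a | ∃ v ∈ vs, a ∈ v.addrs}) s₁.mem)
    (hσ₂ : σ₂ = reachClosure (σ ∪ {a | ∃ v ∈ vs, a ∈ v.addrs}) s₂.mem)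
    (hmem : s₁.mem.restrict σ₁ = s₂.mem.restrict σ₂) (hn : s₁.nalloc = s₂.nalloc) :
    σ₁ = σ₂ ∧ ∃ t₃, Step lim P₃ s₃ t₃ ∧ Merge Y W X Z B AW A AZ σ₁ t₂ t₁ t₃ := by
  have hσ : σ ⊆ σ₂ := by
    rw [hσ₂]
    exact Set.subset_union_left.trans (subset_reachClosure _ _)
  subst hσ₁ hσ₂
  obtain ⟨e₁₂, e₁₃, hm⟩ := h.shared_eq (h.inv₁.args_auth hc₁) (h.inv₂.args_auth hc₂) hmem
  have hi₁ := h.inv₁.cross_call hL₁ hc₁ ht₁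
  have hi₂ := h.inv₂.cross_call hL₂ hc₂ ht₂
  have hmem' := h.resume_mem hσ hm
  refine ⟨e₁₂, ?_⟩
  cases hc₁ with
  | @mk m₁ m₁' f₁ f₁' es₁ stc₁ hf₁ he₁ hg₁ hid₁ hlen₁ hst₁ hfit₁ =>
  cases hc₂ with
  | @mk m₂ m₂' f₂ f₂' es₂ stc₂ hf₂ he₂ hg₂ hid₂ hlen₂ hst₂ hfit₂ =>
    have hm₁ := hf₁.mem_part hL₁ h.inv₁.pcc
    have hm₂ := hf₂.mem_part hL₂ h.inv₂.pcc
    have hm₁' : m₁' ∈ Z := ((hL₁.mem_iff m₁').1 hg₁.1).resolve_left fun hm =>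
      hL₁.not_inCode ⟨f₁', TProgram.mem_funs.2 ⟨m₁', hm, hg₁.2⟩, rfl⟩ ht₁
    have hm₂' : m₂' ∈ Y := ((hL₂.mem_iff m₂').1 hg₂.1).resolve_left fun hm =>
      hL₂.not_inCode ⟨f₂', TProgram.mem_funs.2 ⟨m₂', hm, hg₂.2⟩, rfl⟩ ht₂
    -- The callee's stack capability belongs to `Y`, so it is the same as in the second execution.
    have hst₃ : Function.update s₃.mstc m₁.id (some (s₃.stc.inc f₁.frame)) m₂'.id = some stc₂ := by
      rw [update_mstc_of_foreign hL₃ hm₁ hm₂', ← h.passive.mstc _ hm₂']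
      exact (update_mstc_of_foreign hL₂ hm₂ hm₂').symm.trans hst₂
    have hc₃ : CallStep P₃ s₃ fid vs _ := .mk
      (hf₁.transfer hL₁ hL₃ h.inv₁.pcc h.active.pcc)
      (he₁.imp fun _ _ => h.active.eval h.inv₁) ⟨(hL₃.mem_iff _).2 (.inr hm₂'), hg₂.2⟩ hid₂ hlen₂
      hst₃ hfit₂
    have hi₃ := h.inv₃.cross_call hL₃ hc₃ ht₂
    refine ⟨_, hc₃.step, e₁₂ ▸ hi₂, hi₁, by rw [e₁₃]; exact hi₃, ?_, ?_⟩
    · exact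
        { mem := fun a ha => Mem.pushFrame_congr (hmem' a (e₁₂ ▸ ha))
          nalloc := hn.symm.trans h.active.nalloc
          ddc := rfl
          stc := rfl
          pcc := rfl
          mstc := fun m hm => by
            simp only [update_mstc_of_foreign hL₂ hm₂ hm, update_mstc_of_foreign hL₃ hm₁ hm,
              h.passive.mstc m hm]
          stk := .enter (hL₂.not_inCode h.inv₂.pcc) (hL₃.not_inCode h.inv₃.pcc) h.passive.stk }
    · exact
        { mem := fun a ha => by
            have hA : a ∈ A ∪ σ := .inl ha.1
            have hZ : ¬ (stc₁.st + stc₁.off ≤ a ∧ a < stc₁.st + stc₁.off + f₁'.frame) := fun h' =>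
              Set.disjoint_left.1 h.inv₁.disjoint ha.1
                (h.inv₁.static_passive (hi₁.stc.frame_subset hfit₁ h'))
            have hY : ¬ (stc₂.st + stc₂.off ≤ a ∧ a < stc₂.st + stc₂.off + f₂'.frame) := fun h' =>
              Set.disjoint_left.1 h.inv₃.disjoint ha.1
                (h.inv₃.static_passive (hi₂.stc.frame_subset hfit₂ h'))
            simp only [Mem.pushFrame_of_notMem hZ, Mem.pushFrame_of_notMem hY,
              h.active.mem a hA]
          mstc := fun m hm => by
            simp only [Function.update_apply, h.active.mstc m hm, h.active.stc]
          stk := by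
            simp only [← h.active.ddc, ← h.active.stc, ← h.active.pcc]
            exact .leave h.inv₁.pcc h.active.stk }

/-- When the first two executions return across the border, so does the third one. -/
theorem cross_ret (hL₁ : Linked P₁ X Z) (hL₂ : Linked P₂ W Y) (hL₃ : Linked P₃ X Y)
    (h : Merge X Z Y W A AZ B AW σ s₁ s₂ s₃) {σ₁ σ₂ : Set ℤ}
    (hr₁ : RetStep P₁ s₁ t₁) (ht₁ : InCode Z t₁.pcc)
    (hr₂ : RetStep P₂ s₂ t₂) (ht₂ : InCode Y t₂.pcc)
    (hσ₁ : σ₁ = reachClosure σ t₁.mem) (hσ₂ : σ₂ = reachClosure σ t₂.mem)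
    (hmem : t₁.mem.restrict σ₁ = t₂.mem.restrict σ₂) (hn : s₁.nalloc = s₂.nalloc) :
    σ₁ = σ₂ ∧ ∃ t₃, Step lim P₃ s₃ t₃ ∧ Merge Y W X Z B AW A AZ σ₁ t₂ t₁ t₃ := by
  have hi₁ := h.inv₁.cross_ret hL₁ hr₁ ht₁
  have hi₂ := h.inv₂.cross_ret hL₂ hr₂ ht₂
  subst hσ₁ hσ₂
  cases hr₁ with
  | @mk m₁ f₁ k₁ l₁ hf₁ hk₁ =>
  cases hr₂ with
  | @mk m₂ f₂ k₂ l₂ hf₂ hk₂ =>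
    obtain ⟨e₁₂, e₁₃, hm⟩ := h.shared_eq (S := σ) Set.subset_union_right Set.subset_union_right hmem
    have hmem' := h.resume_mem (subset_reachClosure σ s₂.mem) hm
    have hkZ : EntryOf Z k₁ := (h.inv₁.stk k₁ (hk₁ ▸ List.mem_cons_self)).resolve_left fun hX =>
      hL₁.not_inCode hX.pcc ht₁
    have hkY : EntryOf Y k₂ := (h.inv₂.stk k₂ (hk₂ ▸ List.mem_cons_self)).resolve_left fun hW =>
      hL₂.not_inCode hW.pcc ht₂
    -- The top entry of the merged stack is foreign to `X`, hence of `Y`, hence that of `s₂`.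
    obtain ⟨k₃, l₃, hk₃, hX₃, hstk₁⟩ := (hk₁ ▸ h.active.stk).pop_enter (hL₁.symm.not_inCode ht₁)
    have hY₃ : InCode Y k₃.pcc :=
      ((h.inv₃.stk k₃ (hk₃ ▸ List.mem_cons_self)).resolve_left fun hX => hX₃ hX.pcc).pcc
    obtain ⟨rfl, hstk₂⟩ := (hk₃ ▸ hk₂ ▸ h.passive.stk : SameStack Y false (k₂ :: l₂) (k₃ :: l₃))
      |>.pop_leave ht₂ hY₃
    obtain ⟨mz, hmz, ez⟩ := hkZ.mid
    obtain ⟨my, hmy, ey⟩ := hkY.mid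
    have hr₃ : RetStep P₃ s₃ _ := .mk (hf₁.transfer hL₁ hL₃ h.inv₁.pcc h.active.pcc) hk₃
    have hi₃ := h.inv₃.cross_ret hL₃ hr₃ hY₃
    refine ⟨e₁₂, _, hr₃.step, ?_, hi₁, ?_, ?_, ?_⟩
    · simp only [e₁₂]
      exact hi₂
    · simp only [e₁₃]
      exact hi₃
    · exact
        { mem := fun a ha => hmem' a (by simp only [e₁₂] at ha; exact ha)
          nalloc := hn.symm.trans h.active.nalloc
          ddc := rfl
          stc := rfl
          pcc := rfl
          mstc := fun m hm => by
            simp only [Function.update_apply, h.passive.mstc m hm]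
          stk := hstk₂ }
    · exact
        { mem := fun a ha => h.active.mem a (.inl ha.1)
          mstc := fun m hm => by
            simp only [← ez, ← ey, update_mstc_of_foreign hL₁.symm hmz hm,
              update_mstc_of_foreign hL₃.symm hmy hm, h.active.mstc m hm]
          stk := hstk₁ }

end Merge

/-! ### Labeled steps and the border -/

section Border

variable {P X Y p : TProgram} {A B σ : Set ℤ} {s t : State} {lim : ℕ}

theorem Inv.inCode_of_inProg_iff (hL : Linked P X Y) (h : Inv X Y A B σ s) (hs : Step lim P s t)
    (hp : p = X ∨ p = Y) (hiff : InProg p s ↔ InProg p t) : InCode X t.pcc := by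
  have hc := h.inCode_of_step hL hs
  rcases hp with rfl | rfl
  · exact (hL.subset_codeDom_iff hc).1 (hiff.1 ((hL.subset_codeDom_iff (.inl h.pcc)).2 h.pcc))
  · refine hc.resolve_right fun hY => hL.not_inCode h.pcc ?_
    exact (hL.symm.subset_codeDom_iff (.inr h.pcc)).1
      (hiff.2 ((hL.symm.subset_codeDom_iff (.inl hY)).2 hY))

theorem Inv.inCode_of_crosses (hL : Linked P X Y) (h : Inv X Y A B σ s) (hs : Step lim P s t)
    (hp : p = X ∨ p = Y) {d : Dir} (hd : Crosses p s t d) : InCode Y t.pcc := by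
  have hne : ¬ (InProg p s ↔ InProg p t) := by
    cases d <;> simp only [Crosses] at hd <;> tauto
  refine (h.inCode_of_step hL hs).resolve_left fun hX => hne ?_
  rcases hp with rfl | rfl
  · exact iff_of_true ((hL.subset_codeDom_iff (.inl h.pcc)).2 h.pcc)
      ((hL.subset_codeDom_iff (.inl hX)).2 hX)
  · refine iff_of_false (fun h' => ?_) (fun h' => ?_)
    · exact hL.not_inCode h.pcc ((hL.symm.subset_codeDom_iff (.inr h.pcc)).1 h')
    · exact hL.not_inCode hX ((hL.symm.subset_codeDom_iff (.inr hX)).1 h')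

/-- Every step is a labeled step. -/
theorem Step.exists_label (hs : Step lim P s t) (p : TProgram) (σ : Set ℤ) :
    ∃ l σ', TraceStep lim P p (s, σ) l (t, σ') := by
  by_cases hiff : InProg p s ↔ InProg p t
  · exact ⟨_, _, .tau hs hiff⟩
  · have hd : ∃ d, Crosses p s t d := by
      by_cases h : InProg p s
      · exact ⟨.output, h, fun h' => hiff (iff_of_true h h')⟩
      · exact ⟨.input, h, by_contra fun h' => hiff (iff_of_false h h')⟩
    obtain ⟨d, hd⟩ := hd
    cases hs with
    | assign => exact absurd Iff.rfl hiff
    | alloc => exact absurd Iff.rfl hiff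
    | jumpZero => exact absurd Iff.rfl hiff
    | jumpNonzero => exact absurd Iff.rfl hiff
    | call hf he hg hid hlen hm hst hfit =>
      exact ⟨_, _, .call (.call hf he hg hid hlen hm hst hfit) hf he hd rfl⟩
    | ret hf hk => exact ⟨_, _, .ret (.ret hf hk) hf hd rfl⟩

/-- A converging execution has a trace that contains `✓`. -/
theorem exists_run_tick (p : TProgram) (hs : Relation.ReflTransGen (Step lim P) s t)
    (ht : Terminal P t) (σ : Set ℤ) :
    ∃ α x, Label.tick ∈ α ∧ Run lim P p (s, σ) α x := by
  induction hs using Relation.ReflTransGen.head_induction_on generalizing σ with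
  | refl => exact ⟨_, _, List.mem_cons_self, .visible (.tick ht) nofun (.refl _)⟩
  | head h _ ih =>
    obtain ⟨l, σ', hl⟩ := h.exists_label p σ
    obtain ⟨α, x, hα, hx⟩ := ih σ'
    by_cases hτ : l = .tau
    · subst hτ
      exact ⟨α, x, hα, .tau hl hx⟩
    · exact ⟨_, x, List.mem_cons_of_mem _ hα, .visible hl hτ hx⟩

end Border

/-- When the first two executions cross the border with the same label, so does the third one. -/
theorem Merge.cross {P₁ P₂ P₃ X Z Y W p₁ p₂ : TProgram} {A AZ B AW σ σ₁ σ₂ : Set ℤ}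
    {s₁ s₂ s₃ t₁ t₂ : State} {lim : ℕ} {l : Label}
    (hL₁ : Linked P₁ X Z) (hL₂ : Linked P₂ W Y) (hL₃ : Linked P₃ X Y)
    (hp₁ : p₁ = X ∨ p₁ = Z) (hp₂ : p₂ = W ∨ p₂ = Y)
    (h : Merge X Z Y W A AZ B AW σ s₁ s₂ s₃)
    (hs₁ : TraceStep lim P₁ p₁ (s₁, σ) l (t₁, σ₁)) (hs₂ : TraceStep lim P₂ p₂ (s₂, σ) l (t₂, σ₂))
    (hτ : l ≠ .tau) (htick : l ≠ .tick) :
    σ₁ = σ₂ ∧ ∃ t₃, Step lim P₃ s₃ t₃ ∧ Merge Y W X Z B AW A AZ σ₁ t₂ t₁ t₃ := by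
  cases hs₁ with
  | tau => exact absurd rfl hτ
  | tick => exact absurd rfl htick
  | ret hs hf hd hσ =>
    have ht := h.inv₁.inCode_of_crosses hL₁ hs hp₁ hd
    generalize hl : Label.ret _ _ _ = l at hs₂
    cases hs₂ with
    | tau => cases hl
    | tick => cases hl
    | call => cases hl
    | ret hs' hf' hd' hσ' =>
      injection hl with _ hmem hn
      exact h.cross_ret hL₁ hL₂ hL₃ (hs.retStep hL₁ hf) ht (hs'.retStep hL₂ hf')
        (h.inv₂.inCode_of_crosses hL₂ hs' hp₂ hd') hσ hσ' hmem hn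
  | call hs hf he hd hσ =>
    have ht := h.inv₁.inCode_of_crosses hL₁ hs hp₁ hd
    generalize hl : Label.call _ _ _ _ _ = l at hs₂
    cases hs₂ with
    | tau => cases hl
    | tick => cases hl
    | ret => cases hl
    | call hs' hf' he' hd' hσ' =>
      injection hl with hfid hvs _ hmem hn
      subst hfid hvs
      exact h.cross_call hL₁ hL₂ hL₃ (hs.callStep hL₁ hf he) ht (hs'.callStep hL₂ hf' he')
        (h.inv₂.inCode_of_crosses hL₂ hs' hp₂ hd') hσ hσ' hmem hn

/-- The merged state, whichever part executes: either the context `C` does, as in the first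
execution, or the program `p₂` does, as in the second one. -/
def Merged (C p₁ C' p₂ : TProgram) (σ : Set ℤ) (s₁ s₂ s₃ : State) : Prop :=
  ∃ A A' B B' : Set ℤ,
    Merge C p₁ p₂ C' A A' B B' σ s₁ s₂ s₃ ∨ Merge p₂ C' C p₁ A A' B B' σ s₂ s₁ s₃

/-- Two executions with the same trace, which contains `✓`, merge into an execution that reaches a
terminal state. The induction is on the first run, then on the second: silent steps of the part that
executes are copied, those of the other part are skipped, and border crossings are synchronized. -/
theorem Run.merge {lim : ℕ} {P₁ P₂ P₃ C p₁ C' p₂ : TProgram} (hL₁ : Linked P₁ C p₁)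
    (hL₂ : Linked P₂ C' p₂) (hL₃ : Linked P₃ C p₂) {x₁ x₂ y₁ y₂ : State × Set ℤ} {α : List Label}
    (hr₁ : Run lim P₁ p₁ x₁ α y₁) (hr₂ : Run lim P₂ p₂ x₂ α y₂) (hα : Label.tick ∈ α)
    (hσ : x₁.2 = x₂.2) {s₃ : State} (h : Merged C p₁ C' p₂ x₁.2 x₁.1 x₂.1 s₃) :
    ∃ t₃, Relation.ReflTransGen (Step lim P₃) s₃ t₃ ∧ Terminal P₃ t₃ := by
  induction hr₁ generalizing x₂ s₃ with
  | refl => cases hα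
  | @tau x₁ z₁ y₁ α hs₁ hr₁ ih =>
    cases hs₁ with
    | @tau s₁ t₁ σ hs hiff =>
      obtain ⟨A, A', B, B', h | h⟩ := h
      · obtain ⟨_, t₃, hs₃, h'⟩ := h.step_active hL₁ hL₃ hs
          (h.inv₁.inCode_of_inProg_iff hL₁ hs (.inr rfl) hiff)
        obtain ⟨u, hu, hT⟩ := ih hr₂ hα hσ ⟨_, _, _, _, .inl h'⟩
        exact ⟨u, .head hs₃ hu, hT⟩
      · obtain ⟨_, h'⟩ := h.step_passive hL₁.symm hs
          (h.inv₂.inCode_of_inProg_iff hL₁.symm hs (.inl rfl) hiff)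
        exact ih hr₂ hα hσ ⟨_, _, _, _, .inr h'⟩
  | @visible x₁ z₁ y₁ l α hs₁ hl hr₁ ih =>
    generalize hβ : l :: α = β at hr₂
    induction hr₂ generalizing s₃ with
    | refl => cases hβ
    | @tau x₂ z₂ y₂ β hs₂ hr₂ ih₂ =>
      subst hβ
      cases hs₂ with
      | @tau s₂ t₂ σ hs hiff =>
        obtain ⟨s₁, σ'⟩ := x₁
        obtain rfl : σ' = σ := hσ
        obtain ⟨A, A', B, B', h | h⟩ := h
        · obtain ⟨_, h'⟩ := h.step_passive hL₂ hs
            (h.inv₂.inCode_of_inProg_iff hL₂ hs (.inr rfl) hiff)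
          exact ih₂ ih rfl ⟨_, _, _, _, .inl h'⟩ rfl
        · obtain ⟨_, t₃, hs₃, h'⟩ := h.step_active hL₂.symm hL₃.symm hs
            (h.inv₁.inCode_of_inProg_iff hL₂.symm hs (.inl rfl) hiff)
          obtain ⟨u, hu, hT⟩ := ih₂ ih rfl ⟨_, _, _, _, .inr h'⟩ rfl
          exact ⟨u, .head hs₃ hu, hT⟩
    | @visible x₂ z₂ y₂ l' β hs₂ _ hr₂ _ =>
      obtain ⟨rfl, rfl⟩ := List.cons.inj hβ
      obtain ⟨s₁, σ⟩ := x₁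
      obtain ⟨s₂, σ'⟩ := x₂
      obtain rfl : σ = σ' := hσ
      obtain ⟨t₁, σ₁⟩ := z₁
      obtain ⟨t₂, σ₂⟩ := z₂
      obtain ⟨A, A', B, B', h⟩ := h
      by_cases htick : l = .tick
      · subst htick
        cases hs₁ with
        | tick hT₁ =>
        cases hs₂ with
        | tick hT₂ =>
          exact ⟨s₃, .refl, h.elim (fun h => h.terminal hL₁ hL₃ hT₁)
            (fun h => h.terminal hL₂.symm hL₃.symm hT₂)⟩
      · have hα' : Label.tick ∈ α := (List.mem_cons.1 hα).resolve_left (Ne.symm htick)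
        rcases h with h | h
        · obtain ⟨rfl, t₃, hs₃, h'⟩ :=
            h.cross hL₁ hL₂ hL₃ (.inr rfl) (.inr rfl) hs₁ hs₂ hl htick
          obtain ⟨u, hu, hT⟩ := ih hr₂ hα' rfl ⟨_, _, _, _, .inr h'⟩
          exact ⟨u, .head hs₃ hu, hT⟩
        · obtain ⟨rfl, t₃, hs₃, h'⟩ := h.cross hL₂.symm hL₁.symm hL₃.symm (.inl rfl) (.inl rfl)
            hs₂ hs₁ hl htick
          obtain ⟨u, hu, hT⟩ := ih hr₂ hα' rfl ⟨_, _, _, _, .inl h'⟩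
          exact ⟨u, .head hs₃ hu, hT⟩

/-! ### Initial states -/

theorem IsInit.mem_static {P : TProgram} {s : State} (h : IsInit P s) {a : ℤ}
    (ha : a ∈ P.static) : s.mem a = some (.int 0) := by
  obtain ⟨m, f, _, _, _, _, _, _, _, _, hm, _⟩ := h
  exact hm a ha

theorem IsInit.mstc_eq {P : TProgram} {s : State} (h : IsInit P s) {m : TModule} (hm : m ∈ P) :
    s.mstc m.id = some m.stackCap := by
  obtain ⟨_, _, _, _, _, _, _, _, _, _, _, _, hs, _⟩ := h
  exact hs m hm

theorem TProgram.static_eq_union {P X Y : TProgram} (hL : Linked P X Y) :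
    P.static = X.static ∪ Y.static := by
  ext a
  simp only [TProgram.static, TProgram.mem_segments, hL.mem_iff, Set.mem_ofPred_eq,
    Set.mem_union]
  constructor
  · rintro ⟨I, ⟨m, hm | hm, hI⟩, ha⟩
    · exact .inl ⟨I, ⟨m, hm, hI⟩, ha⟩
    · exact .inr ⟨I, ⟨m, hm, hI⟩, ha⟩
  · rintro (⟨I, ⟨m, hm, hI⟩, ha⟩ | ⟨I, ⟨m, hm, hI⟩, ha⟩)
    · exact ⟨I, ⟨m, .inl hm, hI⟩, ha⟩
    · exact ⟨I, ⟨m, .inr hm, hI⟩, ha⟩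

/-- `s` is the initial state of `P`, whose entry point is the function `f` of `m`. -/
structure StartsAt (P : TProgram) (m : TModule) (f : TFun) (s : State) : Prop where
  init : IsInit P s
  hasFun : P.HasFun m f
  id : f.id = mainId
  fits : m.stack.1 + f.frame ≤ m.stack.2
  pcc : s.pcc = f.codeCap
  ddc : s.ddc = m.dataCap
  stc : s.stc = m.stackCap
  stk : s.stk = []
  nalloc : s.nalloc = -1

theorem IsInit.startsAt {P : TProgram} {s : State} (h : IsInit P s) : ∃ m f, StartsAt P m f s := by
  have h' := h
  obtain ⟨m, f, h₁, h₂, h₃, h₄, h₅, h₆, h₇, h₈, _⟩ := h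
  exact ⟨m, f, h', h₁, h₂, h₃, h₄, h₅, h₆, h₇, h₈⟩

open Classical in
theorem exists_startsAt {P : TProgram} (hP : P.Executable) {m : TModule} {f : TFun}
    (hf : P.HasFun m f) (hid : f.id = mainId) (hfit : m.stack.1 + f.frame ≤ m.stack.2) :
    ∃ s, StartsAt P m f s := by
  refine ⟨⟨fun a => if a ∈ P.static then some (.int 0) else none, -1, [], m.dataCap, m.stackCap,
    f.codeCap, fun i => if h : ∃ m ∈ P, m.id = i then some h.choose.stackCap else none⟩,
    ⟨m, f, hf, hid, hfit, rfl, rfl, rfl, rfl, rfl, fun a ha => if_pos ha, fun a ha => ?_,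
      fun m' hm' => ?_, fun i hi => ?_⟩, hf, hid, hfit, rfl, rfl, rfl, rfl, rfl⟩
  · exact if_neg fun ⟨I, hI, haI⟩ => ha I hI haI
  · have h : ∃ m ∈ P, m.id = m'.id := ⟨m', hm', rfl⟩
    simp only [h, dif_pos]
    rw [List.inj_on_of_nodup_map hP.modules_nodup h.choose_spec.1 hm' h.choose_spec.2]
  · exact dif_neg fun ⟨m, hm, e⟩ => hi m hm e

section Start

variable {P P' X Y Z : TProgram} {m : TModule} {f : TFun} {s s' : State}

theorem StartsAt.inv (hL : Linked P X Y) (h : StartsAt P m f s) (hm : m ∈ X) :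
    Inv X Y X.static Y.static ∅ s where
  pcc := ⟨f, TProgram.mem_funs.2 ⟨m, hm, h.hasFun.2⟩, by rw [h.pcc]⟩
  ddc := h.ddc ▸ TProgram.data_subset_static hm
  stc := h.stc ▸ ⟨TProgram.stack_subset_static hm, le_refl _⟩
  mstc_active m' hm' c hc := by
    rw [h.init.mstc_eq ((hL.mem_iff m').2 (.inl hm'))] at hc
    cases hc
    exact ⟨TProgram.stack_subset_static hm', le_refl _⟩
  mstc_passive m' hm' c hc := by
    rw [h.init.mstc_eq ((hL.mem_iff m').2 (.inr hm'))] at hc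
    cases hc
    exact ⟨TProgram.stack_subset_static hm', le_refl _⟩
  stk k hk := by simp [h.stk] at hk
  static_active := subset_rfl
  static_passive := subset_rfl
  disjoint := hL.static_disjoint
  shared := Set.empty_subset _
  dom a ha := by
    rw [h.init.mem_static (TProgram.static_eq_union hL ▸ ha)]
    nofun
  fresh a ha := by
    have := hL.static_nonneg a ha
    rw [h.nalloc]
    omega
  auth_active a ha v hv := by
    have ha := ha.resolve_right (Set.notMem_empty a)
    rw [h.init.mem_static (TProgram.static_eq_union hL ▸ .inl ha)] at hv
    cases hv
    exact Set.empty_subset _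
  auth_passive a ha v hv := by
    rw [h.init.mem_static (TProgram.static_eq_union hL ▸ .inr ha.1)] at hv
    cases hv
    exact Set.empty_subset _

theorem StartsAt.agreeActive (hL : Linked P X Y) (hL' : Linked P' X Z) (h : StartsAt P m f s)
    (h' : StartsAt P' m f s') : AgreeActive X X.static ∅ s s' where
  mem a ha := by
    have ha := ha.resolve_right (Set.notMem_empty a)
    rw [h.init.mem_static (TProgram.static_eq_union hL ▸ .inl ha),
      h'.init.mem_static (TProgram.static_eq_union hL' ▸ .inl ha)]
  nalloc := h.nalloc.trans h'.nalloc.symm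
  ddc := h.ddc.trans h'.ddc.symm
  stc := h.stc.trans h'.stc.symm
  pcc := h.pcc.trans h'.pcc.symm
  mstc m hm := by
    rw [h.init.mstc_eq ((hL.mem_iff m).2 (.inl hm)), h'.init.mstc_eq ((hL'.mem_iff m).2 (.inl hm))]
  stk := by
    rw [h.stk, h'.stk]
    exact .nil _

theorem StartsAt.agreePassive {m' : TModule} {f' : TFun} (hL : Linked P X Y)
    (hL' : Linked P' X Z) (h : StartsAt P m f s) (h' : StartsAt P' m' f' s') :
    AgreePassive X X.static ∅ s s' where
  mem a ha := by
    rw [h.init.mem_static (TProgram.static_eq_union hL ▸ .inl ha.1),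
      h'.init.mem_static (TProgram.static_eq_union hL' ▸ .inl ha.1)]
  mstc m hm := by
    rw [h.init.mstc_eq ((hL.mem_iff m).2 (.inl hm)), h'.init.mstc_eq ((hL'.mem_iff m).2 (.inl hm))]
  stk := by
    rw [h.stk, h'.stk]
    exact .nil _

/-- If the entry point of the first execution is in `X`, it is that of the merged execution. -/
theorem StartsAt.merge {P₁ P₂ P₃ W : TProgram} {m' : TModule} {f' : TFun} {s₁ s₂ : State}
    (hL₁ : Linked P₁ X Z) (hL₂ : Linked P₂ W Y) (hL₃ : Linked P₃ X Y) (hP₃ : P₃.Executable)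
    (h₁ : StartsAt P₁ m f s₁) (hm : m ∈ X) (h₂ : StartsAt P₂ m' f' s₂) (hm' : m' ∈ W) :
    ∃ s₃, IsInit P₃ s₃ ∧
      Merge X Z Y W X.static Z.static Y.static W.static ∅ s₁ s₂ s₃ := by
  obtain ⟨s₃, h₃⟩ :=
    exists_startsAt hP₃ ⟨(hL₃.mem_iff m).2 (.inl hm), h₁.hasFun.2⟩ h₁.id h₁.fits
  exact ⟨s₃, h₃.init, h₁.inv hL₁ hm, h₂.inv hL₂ hm', h₃.inv hL₃ hm, h₁.agreeActive hL₁ hL₃ h₃,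
    h₂.agreePassive hL₂.symm hL₃.symm h₃⟩

/-- A linked program has its entry point in one part only. -/
theorem Linked.main_unique (hL : Linked P X Y) {m m' : TModule} {f f' : TFun} (hm : m ∈ X)
    (hf : f ∈ m.funs) (hid : f.id = mainId) (hm' : m' ∈ Y) (hf' : f' ∈ m'.funs)
    (hid' : f'.id = mainId) : False :=
  hL.fun_ids_ne f (TProgram.mem_funs.2 ⟨m, hm, hf⟩) f' (TProgram.mem_funs.2 ⟨m', hm', hf'⟩)
    (hid.trans hid'.symm)

end Start

/-! ### Soundness of trace equivalence -/

theorem Converges.of_traceEquiv {lim : ℕ} {p₁ p₂ C : TProgram} (h : TraceEquiv lim p₁ p₂)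
    (h₁ : (link C p₁).Executable) (h₃ : (link C p₂).Executable)
    (hc : Converges lim (link C p₁)) : Converges lim (link C p₂) := by
  obtain ⟨s₁, t₁, hi₁, hs₁, hT₁⟩ := hc
  obtain ⟨α, ⟨u₁, σ₁⟩, hα, hr₁⟩ := exists_run_tick p₁ hs₁ hT₁ ∅
  obtain ⟨C', s₂, u₂, σ₂, h₂, hi₂, hr₂⟩ : α ∈ Tr lim p₂ :=
    h ▸ (⟨C, s₁, u₁, σ₁, h₁, hi₁, hr₁⟩ : α ∈ Tr lim p₁)
  have hL₁ := h₁.linked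
  have hL₂ := h₂.linked
  have hL₃ := h₃.linked
  obtain ⟨m₁, f₁, hst₁⟩ := hi₁.startsAt
  obtain ⟨m₂, f₂, hst₂⟩ := hi₂.startsAt
  obtain ⟨g, hg, hgid, _⟩ := h₃.main
  obtain ⟨m, hm, hgm⟩ := TProgram.mem_funs.1 hg
  have hstart : ∃ s₃, IsInit (link C p₂) s₃ ∧ Merged C p₁ C' p₂ ∅ s₁ s₂ s₃ := by
    rcases (hL₁.mem_iff m₁).1 hst₁.hasFun.1 with hm₁ | hm₁
    · -- The entry point of `C[p₂]` is in `C`, so that of `C'[p₂]` is not in `p₂`.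
      have hm₂ := ((hL₂.mem_iff m₂).1 hst₂.hasFun.1).resolve_right fun hm₂ =>
        hL₃.main_unique hm₁ hst₁.hasFun.2 hst₁.id hm₂ hst₂.hasFun.2 hst₂.id
      obtain ⟨s₃, hi₃, hM⟩ := hst₁.merge hL₁ hL₂ hL₃ h₃ hm₁ hst₂ hm₂
      exact ⟨s₃, hi₃, _, _, _, _, .inl hM⟩
    · -- The entry point of `C[p₂]` is not in `C`, so it is in `p₂`, and is that of `C'[p₂]`.
      have hmp := ((hL₃.mem_iff m).1 hm).resolve_left fun hm =>
        hL₁.main_unique hm hgm hgid hm₁ hst₁.hasFun.2 hst₁.id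
      have hm₂ := ((hL₂.mem_iff m₂).1 hst₂.hasFun.1).resolve_left fun hm₂ =>
        hL₂.main_unique hm₂ hst₂.hasFun.2 hst₂.id hmp hgm hgid
      obtain ⟨s₃, hi₃, hM⟩ := hst₂.merge hL₂.symm hL₁.symm hL₃.symm h₃ hm₂ hst₁ hm₁
      exact ⟨s₃, hi₃, _, _, _, _, .inr hM⟩
  obtain ⟨s₃, hi₃, hM⟩ := hstart
  obtain ⟨t₃, hs₃, hT₃⟩ := hr₁.merge hL₁ hL₂ hL₃ hr₂ hα rfl hM
  exact ⟨s₃, t₃, hi₃, hs₃, hT₃⟩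

theorem TraceEquiv.ctxEquiv {lim : ℕ} {p₁ p₂ : TProgram} (h : TraceEquiv lim p₁ p₂) :
    CtxEquiv lim p₁ p₂ := fun _ h₁ h₂ =>
  ⟨.of_traceEquiv h h₁ h₂, .of_traceEquiv (Eq.symm h) h₂ h₁⟩

end CapPtrs

theorem mainTheorem5 (lim : ℕ) (L₁ L₂ : CapPtrs.Layout) (p₁ p₂ : CapPtrs.SProgram)
    (hp₁ : p₁.WellFormed) (hp₂ : p₂.WellFormed) (t₁ t₂ : CapPtrs.TProgram)
    (ht₁ : CapPtrs.compile L₁ p₁ = some t₁) (ht₂ : CapPtrs.compile L₂ p₂ = some t₂) :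
    (¬ CapPtrs.CtxEquiv lim t₁ t₂ → ¬ CapPtrs.TraceEquiv lim t₁ t₂) ∧
      (CapPtrs.TraceEquiv lim t₁ t₂ → CapPtrs.CtxEquiv lim t₁ t₂) :=
  ⟨mt CapPtrs.TraceEquiv.ctxEquiv, CapPtrs.TraceEquiv.ctxEquiv⟩
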